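/- Let $n\ge 2$, let $\Omega\subseteq\mathbb{R}^n$ be a bounded open set whose boundary has finite $(n-1)$-dimensional Hausdorff measure, and let $x_0\in\Omega$. Suppose that $\partial\Omega$ is a harmonic pseudosphere centered at $x_0$, that is, $$u(x_0)=\frac{1}{|\partial\Omega|}\int_{\partial\Omega}u\,d\sigma$$ for every function $u:\overline\Omega\to\mathbb{R}$ that is harmonic in $\Omega$ and continuous on $\overline\Omega$, where $\sigma$ is the $(n-1)$-dimensional Hausdorff measure and $|\partial\Omega|=\sigma(\partial\Omega)$. Let $z\in\partial\Omega$ be a touching point, that is, $|x_0-z|=\operatorname{dist}(x_0,\partial\Omega)$. Write points of $\mathbb{R}^n=\mathbb{R}^{n-1}\times\mathbb{R}$ as $x=(x',x_n)$, and put $\widehat B_R(z')=\{y\in\mathbb{R}^{n-1}:|y-z'|<R\}$. Suppose that $\partial\Omega$ is Lipschitz flat at $z$, that is, there are $R>0$, real numbers $a<z_n<b$ and a function $\psi:\widehat B_R(z')\to(a,b)$ such that, with $U=\widehat B_R(z')\times(a,b)$, (i) $\psi$ is Lipschitz and everywhere differentiable on $\widehat B_R(z')$, and for almost every $\xi\in\mathbb{R}^{n-1}$,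 $\nabla\psi(z'+t\xi)\to\nabla\psi(z')$ as $t\to0$; (ii) $\partial\Omega\cap U=\{(y,\psi(y)) : y\in\widehat B_R(z')\}$; (iii) $\Omega\cap U=\{(y,t) : y\in\widehat B_R(z'),\ a<t<\psi(y)<b\}$. Then $\partial\Omega$ is the Euclidean sphere centered at $x_0$ through $z$: $$\partial\Omega=\partial B(x_0,|x_0-z|).$$ -/

import Mathlib

/-- The first `d` coordinates `x'` of a point `x = (x', x_n)` of `ℝⁿ = ℝᵈ × ℝ`, where `n = d + 1`. -/
def horizontalPart {d : ℕ} (x : EuclideanSpace ℝ (Fin (d + 1))) : EuclideanSpace ℝ (Fin d) :=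
  WithLp.toLp 2 (fun i : Fin d => x i.castSucc)

/-- The last coordinate `x_n` of a point `x = (x', x_n)` of `ℝⁿ = ℝᵈ × ℝ`, where `n = d + 1`. -/
def lastCoord {d : ℕ} (x : EuclideanSpace ℝ (Fin (d + 1))) : ℝ :=
  x (Fin.last d)

/-- The boundary of `Ω ⊆ ℝⁿ`, `n = d + 1`, is a harmonic pseudosphere centered at `x₀`: `Ω` is a
bounded open set containing `x₀`, its boundary has finite `(n - 1)`-dimensional Hausdorff measure,
and each function that is harmonic in `Ω` and continuous on `closure Ω` has at `x₀` the value given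
by its average over the boundary with respect to that measure (normalized as surface area). -/
structure IsHarmonicPseudosphere {d : ℕ} (Ω : Set (EuclideanSpace ℝ (Fin (d + 1))))
    (x₀ : EuclideanSpace ℝ (Fin (d + 1))) : Prop where
  isOpen : IsOpen Ω
  isBounded : Bornology.IsBounded Ω
  measure_lt_top : MeasureTheory.Measure.euclideanHausdorffMeasure d (frontier Ω) < ⊤
  center_mem : x₀ ∈ Ω
  mean_value : ∀ u : EuclideanSpace ℝ (Fin (d + 1)) → ℝ,
    InnerProductSpace.HarmonicContOnCl u Ω →
      u x₀ = ⨍ x in frontier Ω, u x ∂(MeasureTheory.Measure.euclideanHausdorffMeasure d)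

/-- The touching set of the boundary of `Ω` with respect to `x₀`: the boundary points nearest to
`x₀`. -/
def touchingSet {d : ℕ} (Ω : Set (EuclideanSpace ℝ (Fin (d + 1))))
    (x₀ : EuclideanSpace ℝ (Fin (d + 1))) : Set (EuclideanSpace ℝ (Fin (d + 1))) :=
  {z | z ∈ frontier Ω ∧ dist x₀ z = Metric.infDist x₀ (frontier Ω)}

/-- The rectangular neighborhood `U_R(a, b) = B̂_R(z') × (a, b)` of `z`. -/
def rectNhd {d : ℕ} (z : EuclideanSpace ℝ (Fin (d + 1))) (R a b : ℝ) :
    Set (EuclideanSpace ℝ (Fin (d + 1))) :=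
  {x | horizontalPart x ∈ Metric.ball (horizontalPart z) R ∧ lastCoord x ∈ Set.Ioo a b}

/-- Lipschitz flatness of the boundary of `Ω` at its point `z`. Only the values of `ψ` on the ball
`B̂_R(z')` matter. -/
def IsLipschitzFlatAt {d : ℕ} (Ω : Set (EuclideanSpace ℝ (Fin (d + 1))))
    (z : EuclideanSpace ℝ (Fin (d + 1))) : Prop :=
  ∃ (R a b : ℝ) (ψ : EuclideanSpace ℝ (Fin d) → ℝ),
    0 < R ∧ a < lastCoord z ∧ lastCoord z < b ∧
    (∀ y ∈ Metric.ball (horizontalPart z) R, ψ y ∈ Set.Ioo a b) ∧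
    (∃ K : NNReal, LipschitzOnWith K ψ (Metric.ball (horizontalPart z) R)) ∧
    (∀ y ∈ Metric.ball (horizontalPart z) R, DifferentiableAt ℝ ψ y) ∧
    (∀ᵐ ξ : EuclideanSpace ℝ (Fin d),
      Filter.Tendsto (fun t : ℝ => gradient ψ (horizontalPart z + t • ξ))
        (nhdsWithin 0 {0}ᶜ) (nhds (gradient ψ (horizontalPart z)))) ∧
    frontier Ω ∩ rectNhd z R a b =
      {x | horizontalPart x ∈ Metric.ball (horizontalPart z) R ∧
        lastCoord x = ψ (horizontalPart x)} ∧
    Ω ∩ rectNhd z R a b =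
      {x | horizontalPart x ∈ Metric.ball (horizontalPart z) R ∧
        a < lastCoord x ∧ lastCoord x < ψ (horizontalPart x) ∧ ψ (horizontalPart x) < b}

/-!
Write `σ` for the `d`-dimensional Hausdorff measure, `r = |z - x₀|`, and `B` for the ball with
center `x₀` and radius `r`, which lies in `Ω` and touches `∂Ω` at `z`. The theorem follows from two
opposite inequalities between `σ (∂Ω)` and `σ (∂B)`.

* `σ (∂Ω) ≤ σ (∂B)`. For a pole `ζ` just above `z`, hence outside `closure Ω`, the Poisson kernel
  `(|ζ - x₀|² - |x - x₀|²) / |x - ζ|ᵈ⁺¹` is harmonic off `ζ` (`harmonicAt_poissonKernelAt`), so it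
  may be inserted in the mean value property. Since `∂Ω` lies outside `B`, its numerator is at most
  `|ζ - x₀|² - r²` on `∂Ω`, which is of order `t = |ζ - z|`, and so
  `|ζ - x₀|^(1 - d) σ (∂Ω) ≤ (|ζ - x₀|² - r²) ∫ |x - ζ|^(-d-1) dσ(x)`
  (`IsHarmonicPseudosphere.kernel_bound`). As `t → 0`, only the graph near `z` contributes to
  the right-hand side. Rescaling by `t` turns that graph into its tangent hyperplane; the Lipschitz
  bound provides the majorant for dominated convergence, and the radial convergence of `∇ψ` the
  convergence of the area density (`tendsto_lintegral_graphMap`). The hyperplane integral is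
  the area of a half sphere in central projection, and tangency to `∂B` makes the constants match
  (`IsHarmonicPseudosphere.frontier_le`). This compares the densities at `z` of the
  harmonic measures of `Ω` and `B`.
* `σ (∂B) < σ (∂Ω)` if `Ω` has a point outside the closed ball: the radial projection maps `∂Ω`
  onto `∂B`, contracts distances, and does so strictly over an open set of directions
  (`euclideanHausdorffMeasure_sphere_lt_frontier`).

Hence `Ω` is contained in the closed ball, so it is the open ball `B`.

The Hausdorff measures of graphs and of half spheres are computed by the area formula
`euclideanHausdorffMeasure_image_eq_lintegral_normDet` for injective maps with injective
derivatives; it is proved by cutting the domain into countably many pieces on which the map is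
nearly linear.
-/

open MeasureTheory Measure Set Filter Topology Function
open scoped NNReal ENNReal


/-! ### The area formula -/

section AreaFormula

theorem pairwise_disjoint_inter {α ι : Type*} {s : Set α} {t : ι → Set α}
    (h : Pairwise (Disjoint on t)) : Pairwise (Disjoint on fun i => s ∩ t i) :=
  fun _ _ hij => (h hij).mono inter_subset_right inter_subset_right

/-- If distances between the values of `g` on `s` are at most `K` times those between the values
of `f`, then `g '' s` is a Lipschitz image of `f '' s`. -/
theorem euclideanHausdorffMeasure_image_le_of_dist_le {α X Y : Type*}
    [MetricSpace X] [MeasurableSpace X] [BorelSpace X]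
    [MetricSpace Y] [MeasurableSpace Y] [BorelSpace Y]
    {f : α → X} {g : α → Y} {s : Set α} {K : ℝ≥0} (n : ℕ)
    (h : ∀ x ∈ s, ∀ y ∈ s, dist (g x) (g y) ≤ K * dist (f x) (f y)) :
    μHE[n] (g '' s) ≤ (K : ℝ≥0∞) ^ n * μHE[n] (f '' s) := by
  rcases s.eq_empty_or_nonempty with rfl | ⟨a, -⟩
  · simp
  have : Nonempty α := ⟨a⟩
  have hinv : ∀ x ∈ s, invFunOn f s (f x) ∈ s ∧ f (invFunOn f s (f x)) = f x := fun x hx =>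
    ⟨invFunOn_mem ⟨x, hx, rfl⟩, invFunOn_eq ⟨x, hx, rfl⟩⟩
  have hg : ∀ x ∈ s, g (invFunOn f s (f x)) = g x := fun x hx => by
    have := h _ (hinv x hx).1 x hx
    rw [(hinv x hx).2, dist_self, mul_zero] at this
    exact dist_le_zero.1 this
  have hlip : LipschitzOnWith K (fun p => g (invFunOn f s p)) (f '' s) := by
    refine LipschitzOnWith.of_dist_le_mul ?_
    rintro _ ⟨x, hx, rfl⟩ _ ⟨y, hy, rfl⟩
    simpa only [hg x hx, hg y hy] using h x hx y hy
  have himg : (fun p => g (invFunOn f s p)) '' (f '' s) = g '' s := by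
    rw [image_image]
    exact image_congr hg
  have hH := hlip.hausdorffMeasure_image_le (d := (n : ℝ)) n.cast_nonneg
  rw [himg, ENNReal.rpow_natCast] at hH
  simp only [euclideanHausdorffMeasure_def, Measure.smul_apply, nnreal_smul_coe_apply]
  calc _ ≤ _ := mul_le_mul_right hH _
    _ = _ := mul_left_comm _ _ _

variable {U V : Type*} [NormedAddCommGroup U] [InnerProductSpace ℝ U] [FiniteDimensional ℝ U]
  [NormedAddCommGroup V] [InnerProductSpace ℝ V]

theorem continuous_normDet [FiniteDimensional ℝ V] :
    Continuous fun A : U →L[ℝ] V => (A : U →ₗ[ℝ] V).normDet := by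
  have h : ∀ A : U →L[ℝ] V,
      (A : U →ₗ[ℝ] V).normDet = √((ContinuousLinearMap.adjoint A ∘L A).det) := by
    intro A
    rw [← A.normDet_sq]
    exact (Real.sqrt_sq (LinearMap.normDet_nonneg _)).symm
  simp_rw [h]
  refine Real.continuous_sqrt.comp (ContinuousLinearMap.continuous_det.comp ?_)
  exact (ContinuousLinearMap.adjoint (𝕜 := ℝ) (E := U) (F := V)).continuous.clm_comp continuous_id

theorem normDet_pos_of_injective {A : U →L[ℝ] V} (hA : Injective A) :
    0 < (A : U →ₗ[ℝ] V).normDet :=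
  lt_of_le_of_ne (LinearMap.normDet_nonneg _)
    (Ne.symm (((A : U →ₗ[ℝ] V).normDet_ne_zero_tfae.out 0 4).2 hA))

variable [MeasurableSpace U] [BorelSpace U] [MeasurableSpace V] [BorelSpace V]

/-- The image under an approximately linear map is a Lipschitz image of the linear one. -/
theorem ApproximatesLinearOn.euclideanHausdorffMeasure_image_le {f : U → V} {A : U →L[ℝ] V}
    {s : Set U} {δ η : ℝ≥0} (hf : ApproximatesLinearOn f A s δ)
    (hδ : ∀ w, (δ : ℝ) * ‖w‖ ≤ η * ‖A w‖) :
    μHE[Module.finrank ℝ U] (f '' s) ≤ ((1 + η : ℝ≥0) : ℝ≥0∞) ^ Module.finrank ℝ U *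
      (ENNReal.ofReal (A : U →ₗ[ℝ] V).normDet * volume s) := by
  rw [← LinearMap.euclideanHausdorffMeasure_image_eq_normDet_mul_volume]
  refine euclideanHausdorffMeasure_image_le_of_dist_le _ fun x hx y hy => ?_
  have h1 := hf x hx y hy
  have h2 := hδ (x - y)
  have h3 := norm_le_norm_add_norm_sub' (f x - f y) (A (x - y))
  have h4 : dist (A x) (A y) = ‖A (x - y)‖ := by rw [map_sub, dist_eq_norm]
  rw [dist_eq_norm (f x), ContinuousLinearMap.coe_coe, h4]
  push_cast
  linarith

/-- The linear image is a Lipschitz image of the one under an approximately linear map. -/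
theorem ApproximatesLinearOn.le_euclideanHausdorffMeasure_image {f : U → V} {A : U →L[ℝ] V}
    {s : Set U} {δ η K : ℝ≥0} (hf : ApproximatesLinearOn f A s δ)
    (hδ : ∀ w, (δ : ℝ) * ‖w‖ ≤ η * ‖A w‖) (hK : 1 ≤ K * (1 - (η : ℝ))) :
    ENNReal.ofReal (A : U →ₗ[ℝ] V).normDet * volume s ≤
      (K : ℝ≥0∞) ^ Module.finrank ℝ U * μHE[Module.finrank ℝ U] (f '' s) := by
  rw [← LinearMap.euclideanHausdorffMeasure_image_eq_normDet_mul_volume]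
  refine euclideanHausdorffMeasure_image_le_of_dist_le _ fun x hx y hy => ?_
  have h1 := hf x hx y hy
  have h2 := hδ (x - y)
  have h3 := norm_sub_norm_le (A (x - y)) (A (x - y) - (f x - f y))
  rw [sub_sub_cancel, norm_sub_rev (A (x - y))] at h3
  have h4 : dist (A x) (A y) = ‖A (x - y)‖ := by rw [map_sub, dist_eq_norm]
  rw [dist_eq_norm (f x), ContinuousLinearMap.coe_coe, h4]
  have h5 : (1 - (η : ℝ)) * ‖A (x - y)‖ ≤ ‖f x - f y‖ := by linarith
  calc ‖A (x - y)‖ ≤ K * (1 - (η : ℝ)) * ‖A (x - y)‖ :=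
        le_mul_of_one_le_left (norm_nonneg _) hK
    _ = K * ((1 - (η : ℝ)) * ‖A (x - y)‖) := mul_assoc _ _ _
    _ ≤ K * ‖f x - f y‖ := by gcongr

/-- Near an injective linear map, approximability forces the volume distortion to be close to
the Jacobian. -/
theorem exists_approximatesLinearOn_volume_bounds {A : U →L[ℝ] V} (hA : Injective A) {κ : ℝ≥0}
    (hκ : 1 < κ) : ∃ δ : ℝ≥0, δ ≠ 0 ∧ ∀ (f : U → V) (s : Set U), ApproximatesLinearOn f A s δ →
      μHE[Module.finrank ℝ U] (f '' s) ≤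
        κ * (ENNReal.ofReal (A : U →ₗ[ℝ] V).normDet * volume s) ∧
      ENNReal.ofReal (A : U →ₗ[ℝ] V).normDet * volume s ≤
        κ * μHE[Module.finrank ℝ U] (f '' s) := by
  obtain ⟨K, hK0, hK⟩ := (A : U →ₗ[ℝ] V).exists_antilipschitzWith (LinearMap.ker_eq_bot.2 hA)
  set N := Module.finrank ℝ U
  -- a factor `θ > 1` whose `N`-th power is at most `κ`
  obtain ⟨θ, hθ1, hθκ⟩ : ∃ θ : ℝ≥0, 1 < θ ∧ θ ^ N < κ := by
    have hc : ContinuousAt (fun x : ℝ≥0 => x ^ N) 1 := by fun_prop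
    have hev : ∀ᶠ x in 𝓝[>] (1 : ℝ≥0), x ^ N < κ :=
      (hc.eventually_lt continuousAt_const (by simpa using hκ)).filter_mono nhdsWithin_le_nhds
    obtain ⟨x, hx, hx1⟩ := (hev.and self_mem_nhdsWithin).exists
    exact ⟨x, hx1, hx⟩
  -- then `1 + η ≤ θ` and `θ (1 - η) = 1`
  set η : ℝ≥0 := 1 - θ⁻¹ with hη
  have hθ0 : (0 : ℝ) < θ := by exact_mod_cast zero_lt_one.trans hθ1
  have hθ1' : (1 : ℝ) < θ := by exact_mod_cast hθ1
  have hinv : θ⁻¹ < 1 := inv_lt_one_of_one_lt₀ hθ1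
  have hηr : (η : ℝ) = 1 - (θ : ℝ)⁻¹ := by
    rw [hη, NNReal.coe_sub hinv.le]; simp
  have hη0 : 0 < η := tsub_pos_of_lt hinv
  have hδ : ∀ w, ((η / K : ℝ≥0) : ℝ) * ‖w‖ ≤ η * ‖A w‖ := by
    intro w
    have := hK.le_mul_dist w 0
    simp only [map_zero, dist_zero_right, ContinuousLinearMap.coe_coe] at this
    rw [NNReal.coe_div, div_mul_eq_mul_div, div_le_iff₀ (by exact_mod_cast hK0), mul_assoc]
    gcongr
    linarith
  refine ⟨η / K, (div_pos hη0 hK0).ne', fun f s hf => ⟨?_, ?_⟩⟩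
  · refine (hf.euclideanHausdorffMeasure_image_le hδ).trans ?_
    gcongr
    have : (1 + η) ^ N ≤ κ := by
      refine (pow_le_pow_left₀ zero_le ?_ N).trans hθκ.le
      have : (1 + η : ℝ) ≤ θ := by
        rw [hηr]
        have : (θ : ℝ) * (θ : ℝ)⁻¹ = 1 := mul_inv_cancel₀ hθ0.ne'
        have h2 : (θ : ℝ)⁻¹ < 1 := by exact_mod_cast hinv
        nlinarith
      exact_mod_cast this
    exact_mod_cast this
  · refine (hf.le_euclideanHausdorffMeasure_image hδ (K := θ) ?_).trans ?_
    · rw [hηr, sub_sub_cancel, mul_inv_cancel₀ hθ0.ne']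
    · gcongr
      exact_mod_cast hθκ.le

variable [FiniteDimensional ℝ V]

/-- The area formula up to a factor `κ ^ 3`, for maps whose derivatives are all close to one
injective linear map. -/
theorem exists_nhds_area_bounds {A₀ : U →L[ℝ] V} (hA₀ : Injective A₀) {κ : ℝ≥0} (hκ : 1 < κ) :
    ∃ O : Set (U →L[ℝ] V), IsOpen O ∧ A₀ ∈ O ∧ ∀ (f : U → V) (f' : U → U →L[ℝ] V) (s : Set U),
      MeasurableSet s → (∀ x ∈ s, HasFDerivWithinAt f (f' x) s x) → (∀ x ∈ s, f' x ∈ O) →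
      InjOn f s →
      μHE[Module.finrank ℝ U] (f '' s) ≤
        κ ^ 3 * ∫⁻ x in s, ENNReal.ofReal (f' x : U →ₗ[ℝ] V).normDet ∧
      ∫⁻ x in s, ENNReal.ofReal (f' x : U →ₗ[ℝ] V).normDet ≤
        κ ^ 3 * μHE[Module.finrank ℝ U] (f '' s) := by
  set J : (U →L[ℝ] V) → ℝ := fun A => (A : U →ₗ[ℝ] V).normDet with hJ
  have hJc : Continuous J := continuous_normDet
  have hJ0 : 0 < J A₀ := normDet_pos_of_injective hA₀
  have hκ' : (1 : ℝ) < κ := by exact_mod_cast hκ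
  -- all Jacobians on the neighborhood agree with that of `A₀` up to the factor `κ`; the first
  -- inequality also makes the maps in it injective
  refine ⟨{B | J A₀ < κ * J B ∧ J B < κ * J A₀},
    IsOpen.inter (isOpen_lt (f := fun _ => J A₀) (g := fun B => κ * J B) continuous_const
      (continuous_const.mul hJc)) (isOpen_lt (g := fun _ => κ * J A₀) hJc continuous_const),
    ⟨by nlinarith, by nlinarith⟩, fun f f' s hs hf' hO hinj => ?_⟩
  have hOinj : ∀ B, J A₀ < κ * J B → Injective B := by
    intro B hB
    refine ((B : U →ₗ[ℝ] V).normDet_ne_zero_tfae.out 0 4).1 fun h0 => ?_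
    have : J B = 0 := h0
    rw [this, mul_zero] at hB
    exact absurd hB (not_lt.2 hJ0.le)
  have hJ1 : ∀ B, J A₀ < κ * J B → ENNReal.ofReal (J A₀) ≤ κ * ENNReal.ofReal (J B) := by
    intro B hB
    rw [← ENNReal.ofReal_coe_nnreal, ← ENNReal.ofReal_mul κ.coe_nonneg]
    exact ENNReal.ofReal_le_ofReal hB.le
  have hJ2 : ∀ B, J B < κ * J A₀ → ENNReal.ofReal (J B) ≤ κ * ENNReal.ofReal (J A₀) := by
    intro B hB
    rw [← ENNReal.ofReal_coe_nnreal, ← ENNReal.ofReal_mul κ.coe_nonneg]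
    exact ENNReal.ofReal_le_ofReal hB.le
  rcases s.eq_empty_or_nonempty with rfl | hne
  · simp
  -- the precision of the linear approximation; a value at noninjective maps plays no role
  have hex : ∀ A : U →L[ℝ] V, ∃ δ : ℝ≥0, δ ≠ 0 ∧ (Injective A → ∀ (f : U → V) (s : Set U),
      ApproximatesLinearOn f A s δ →
      μHE[Module.finrank ℝ U] (f '' s) ≤ κ * (ENNReal.ofReal (J A) * volume s) ∧
      ENNReal.ofReal (J A) * volume s ≤ κ * μHE[Module.finrank ℝ U] (f '' s)) := by
    intro A
    by_cases hA : Injective A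
    · obtain ⟨δ, h0, h⟩ := exists_approximatesLinearOn_volume_bounds hA hκ
      exact ⟨δ, h0, fun _ => h⟩
    · exact ⟨1, one_ne_zero, fun h => absurd h hA⟩
  choose δ hδ0 hδ using hex
  obtain ⟨t, A, tdisj, tmeas, tcov, tapp, tA⟩ :=
    exists_partition_approximatesLinearOn_of_hasFDerivWithinAt f s f' hf' δ hδ0
  have hAO : ∀ n, J A₀ < κ * J (A n) ∧ J (A n) < κ * J A₀ := by
    intro n
    obtain ⟨y, hy, hAy⟩ := tA hne n
    rw [hAy]; exact hO y hy
  have hs_eq : s = ⋃ n, s ∩ t n := by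
    rw [← inter_iUnion, inter_eq_self_of_subset_left tcov]
  have hm : ∀ n, MeasurableSet (s ∩ t n) := fun n => hs.inter (tmeas n)
  have hint : ∫⁻ x in s, ENNReal.ofReal (J (f' x)) =
      ∑' n, ∫⁻ x in s ∩ t n, ENNReal.ofReal (J (f' x)) := by
    conv_lhs => rw [hs_eq]
    exact lintegral_iUnion hm (pairwise_disjoint_inter tdisj) _
  have hcont : ContinuousOn f s := fun x hx => (hf' x hx).continuousWithinAt
  have hmeas : μHE[Module.finrank ℝ U] (f '' s) =
      ∑' n, μHE[Module.finrank ℝ U] (f '' (s ∩ t n)) := by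
    conv_lhs => rw [hs_eq, image_iUnion]
    refine measure_iUnion (fun i j hij => ?_) fun n => ?_
    · exact Disjoint.image (pairwise_disjoint_inter tdisj hij) hinj inter_subset_left
        inter_subset_left
    · exact (hm n).image_of_continuousOn_injOn (hcont.mono inter_subset_left)
        (hinj.mono inter_subset_left)
  rw [hmeas]
  change _ ≤ _ * ∫⁻ x in s, ENNReal.ofReal (J (f' x)) ∧ ∫⁻ x in s, ENNReal.ofReal (J (f' x)) ≤ _
  rw [hint, ← ENNReal.tsum_mul_left, ← ENNReal.tsum_mul_left]
  refine ⟨ENNReal.tsum_le_tsum fun n => ?_, ENNReal.tsum_le_tsum fun n => ?_⟩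
  · calc μHE[Module.finrank ℝ U] (f '' (s ∩ t n))
        ≤ κ * (ENNReal.ofReal (J (A n)) * volume (s ∩ t n)) :=
          (hδ (A n) (hOinj _ (hAO n).1) f _ (tapp n)).1
      _ ≤ κ * (κ * ENNReal.ofReal (J A₀) * volume (s ∩ t n)) := by
          gcongr; exact hJ2 _ (hAO n).2
      _ = κ * κ * ∫⁻ _ in s ∩ t n, ENNReal.ofReal (J A₀) := by
          rw [setLIntegral_const]; ring
      _ ≤ κ * κ * ∫⁻ x in s ∩ t n, κ * ENNReal.ofReal (J (f' x)) := by
          refine mul_le_mul_right (setLIntegral_mono' (hm n) fun x hx => ?_) _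
          exact hJ1 _ (hO x hx.1).1
      _ = κ ^ 3 * ∫⁻ x in s ∩ t n, ENNReal.ofReal (J (f' x)) := by
          rw [lintegral_const_mul' _ _ ENNReal.coe_ne_top]; ring
  · calc ∫⁻ x in s ∩ t n, ENNReal.ofReal (J (f' x))
        ≤ ∫⁻ x in s ∩ t n, κ * ENNReal.ofReal (J A₀) :=
          setLIntegral_mono' (hm n) fun x hx => hJ2 _ (hO x hx.1).2
      _ = κ * (ENNReal.ofReal (J A₀) * volume (s ∩ t n)) := by
          rw [setLIntegral_const]; ring
      _ ≤ κ * (κ * ENNReal.ofReal (J (A n)) * volume (s ∩ t n)) := by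
          gcongr; exact hJ1 _ (hAO n).1
      _ = κ * κ * (ENNReal.ofReal (J (A n)) * volume (s ∩ t n)) := by ring
      _ ≤ κ * κ * (κ * μHE[Module.finrank ℝ U] (f '' (s ∩ t n))) := by
          exact mul_le_mul_right (hδ (A n) (hOinj _ (hAO n).1) f _ (tapp n)).2 _
      _ = κ ^ 3 * μHE[Module.finrank ℝ U] (f '' (s ∩ t n)) := by ring

/-- Area formula: the Hausdorff measure of the image of an injective map with injective
derivatives is the integral of its Jacobian. -/
theorem euclideanHausdorffMeasure_image_eq_lintegral_normDet {f : U → V} {f' : U → U →L[ℝ] V}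
    {s : Set U} (hs : MeasurableSet s) (hf' : ∀ x ∈ s, HasFDerivWithinAt f (f' x) s x)
    (hf'm : Measurable f') (hf'i : ∀ x ∈ s, Injective (f' x)) (hinj : InjOn f s) :
    μHE[Module.finrank ℝ U] (f '' s) =
      ∫⁻ x in s, ENNReal.ofReal (f' x : U →ₗ[ℝ] V).normDet := by
  set J : U → ℝ≥0∞ := fun x => ENNReal.ofReal (f' x : U →ₗ[ℝ] V).normDet with hJ
  rcases s.eq_empty_or_nonempty with rfl | ⟨a, ha⟩
  · simp
  have key : ∀ κ : ℝ≥0, 1 < κ →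
      μHE[Module.finrank ℝ U] (f '' s) ≤ κ ^ 3 * ∫⁻ x in s, J x ∧
      ∫⁻ x in s, J x ≤ κ ^ 3 * μHE[Module.finrank ℝ U] (f '' s) := by
    intro κ hκ
    -- countably many of the neighborhoods of `exists_nhds_area_bounds` contain all values of `f'`
    have hex : ∀ A₀ : {A : U →L[ℝ] V // Injective A}, ∃ O : Set (U →L[ℝ] V), IsOpen O ∧ A₀.1 ∈ O ∧
        ∀ (f : U → V) (f' : U → U →L[ℝ] V) (s : Set U),
        MeasurableSet s → (∀ x ∈ s, HasFDerivWithinAt f (f' x) s x) → (∀ x ∈ s, f' x ∈ O) →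
        InjOn f s →
        μHE[Module.finrank ℝ U] (f '' s) ≤
          κ ^ 3 * ∫⁻ x in s, ENNReal.ofReal (f' x : U →ₗ[ℝ] V).normDet ∧
        ∫⁻ x in s, ENNReal.ofReal (f' x : U →ₗ[ℝ] V).normDet ≤
          κ ^ 3 * μHE[Module.finrank ℝ U] (f '' s) :=
      fun A₀ => exists_nhds_area_bounds A₀.2 hκ
    choose O hOo hOmem hO using hex
    obtain ⟨T, hTc, hT⟩ := TopologicalSpace.isOpen_iUnion_countable O hOo
    have hTne : T.Nonempty := by
      have : f' a ∈ ⋃ i ∈ T, O i := by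
        rw [hT]; exact mem_iUnion.2 ⟨⟨f' a, hf'i a ha⟩, hOmem _⟩
      obtain ⟨i, hi, -⟩ := mem_iUnion₂.1 this
      exact ⟨i, hi⟩
    obtain ⟨e, he⟩ := hTc.exists_eq_range hTne
    set t : ℕ → Set U := disjointed fun n => f' ⁻¹' O (e n) with ht
    have tmeas : ∀ n, MeasurableSet (t n) :=
      MeasurableSet.disjointed fun n => hf'm (hOo (e n)).measurableSet
    have tdisj : Pairwise (Disjoint on t) := disjoint_disjointed _
    have tcov : s ⊆ ⋃ n, t n := by
      rw [ht, iUnion_disjointed]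
      intro x hx
      have : f' x ∈ ⋃ i ∈ T, O i := by
        rw [hT]; exact mem_iUnion.2 ⟨⟨f' x, hf'i x hx⟩, hOmem _⟩
      obtain ⟨i, hi, hxi⟩ := mem_iUnion₂.1 this
      rw [he] at hi
      obtain ⟨n, rfl⟩ := hi
      exact mem_iUnion.2 ⟨n, hxi⟩
    have hs_eq : s = ⋃ n, s ∩ t n := by
      rw [← inter_iUnion, inter_eq_self_of_subset_left tcov]
    have hm : ∀ n, MeasurableSet (s ∩ t n) := fun n => hs.inter (tmeas n)
    have hint : ∫⁻ x in s, J x = ∑' n, ∫⁻ x in s ∩ t n, J x := by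
      conv_lhs => rw [hs_eq]
      exact lintegral_iUnion hm (pairwise_disjoint_inter tdisj) _
    have hcont : ContinuousOn f s := fun x hx => (hf' x hx).continuousWithinAt
    have hmeas : μHE[Module.finrank ℝ U] (f '' s) =
        ∑' n, μHE[Module.finrank ℝ U] (f '' (s ∩ t n)) := by
      conv_lhs => rw [hs_eq, image_iUnion]
      refine measure_iUnion (fun i j hij => ?_) fun n => ?_
      · exact Disjoint.image (pairwise_disjoint_inter tdisj hij) hinj inter_subset_left
          inter_subset_left
      · exact (hm n).image_of_continuousOn_injOn (hcont.mono inter_subset_left)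
          (hinj.mono inter_subset_left)
    have hn := fun n => hO (e n) f f' (s ∩ t n) (hm n)
      (fun x hx => (hf' x hx.1).mono inter_subset_left)
      (fun x hx => disjointed_subset _ n hx.2) (hinj.mono inter_subset_left)
    rw [hmeas, hint, ← ENNReal.tsum_mul_left, ← ENNReal.tsum_mul_left]
    exact ⟨ENNReal.tsum_le_tsum fun n => (hn n).1, ENNReal.tsum_le_tsum fun n => (hn n).2⟩
  have hlim : ∀ c : ℝ≥0∞, Tendsto (fun κ : ℝ≥0 => (κ : ℝ≥0∞) ^ 3 * c) (𝓝[>] 1) (𝓝 c) := by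
    intro c
    have h1 : Tendsto (fun κ : ℝ≥0 => ((κ ^ 3 : ℝ≥0) : ℝ≥0∞)) (𝓝[>] 1) (𝓝 ((1 ^ 3 : ℝ≥0) : ℝ≥0∞)) :=
      (ENNReal.tendsto_coe.2 ((continuous_pow 3).tendsto 1)).mono_left nhdsWithin_le_nhds
    have h2 := ENNReal.Tendsto.mul_const (b := c) h1 (Or.inl (by simp))
    simpa using h2
  refine le_antisymm (ge_of_tendsto (hlim _) ?_) (ge_of_tendsto (hlim _) ?_)
  · filter_upwards [self_mem_nhdsWithin] with κ hκ using (key κ hκ).1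
  · filter_upwards [self_mem_nhdsWithin] with κ hκ using (key κ hκ).2

/-- Area formula for integrals over a parametrized surface. -/
theorem setLIntegral_image_eq_lintegral_normDet {f : U → V} {f' : U → U →L[ℝ] V}
    {s : Set U} (hs : MeasurableSet s) (hf' : ∀ x ∈ s, HasFDerivWithinAt f (f' x) s x)
    (hf'm : Measurable f') (hf'i : ∀ x ∈ s, Injective (f' x)) (hinj : InjOn f s)
    (hf : Measurable f) {g : V → ℝ≥0∞} (hg : Measurable g) :
    ∫⁻ x in f '' s, g x ∂μHE[Module.finrank ℝ U] =
      ∫⁻ x in s, ENNReal.ofReal (f' x : U →ₗ[ℝ] V).normDet * g (f x) := by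
  have hJm : Measurable fun x => ENNReal.ofReal (f' x : U →ₗ[ℝ] V).normDet :=
    ENNReal.measurable_ofReal.comp (continuous_normDet.measurable.comp hf'm)
  have hmap : (μHE[Module.finrank ℝ U] : Measure V).restrict (f '' s) =
      Measure.map f ((volume.restrict s).withDensity
        fun x => ENNReal.ofReal (f' x : U →ₗ[ℝ] V).normDet) := by
    refine Measure.ext fun t ht => ?_
    rw [Measure.map_apply hf ht, withDensity_apply _ (hf ht), restrict_restrict (hf ht),
      Measure.restrict_apply ht, ← image_preimage_inter]
    exact euclideanHausdorffMeasure_image_eq_lintegral_normDet ((hf ht).inter hs)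
      (fun x hx => (hf' x hx.2).mono inter_subset_right) hf'm (fun x hx => hf'i x hx.2)
      (hinj.mono inter_subset_right)
  rw [hmap, lintegral_map hg hf, lintegral_withDensity_eq_lintegral_mul _ hJm
    (g := fun x => g (f x)) (hg.comp hf)]
  rfl

end AreaFormula

/-! ### Gnomonic coordinates and the area of spheres -/

section Gnomonic

variable {U E : Type*} [NormedAddCommGroup U]

/-- The factor `1 / √(1 + ‖y‖²)` that brings the point `(y, 1)` to the unit sphere. -/
noncomputable def invHypot (y : U) : ℝ := (√(1 + ‖y‖ ^ 2))⁻¹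

theorem invHypot_pos (y : U) : 0 < invHypot y := by
  unfold invHypot; positivity

theorem invHypot_sq (y : U) : invHypot y ^ 2 * (1 + ‖y‖ ^ 2) = 1 := by
  unfold invHypot
  rw [inv_pow, Real.sq_sqrt (by positivity), inv_mul_cancel₀ (by positivity)]

theorem continuous_invHypot : Continuous (invHypot : U → ℝ) := by
  unfold invHypot
  exact Continuous.inv₀ (by fun_prop) fun y => by positivity

variable [InnerProductSpace ℝ U] [NormedAddCommGroup E] [InnerProductSpace ℝ E]

/-- Jacobian of a linear map whose Gram form is a rank-one perturbation of a multiple of the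
inner product. -/
theorem normDet_sq_of_inner_eq [FiniteDimensional ℝ U] (A : U →L[ℝ] E) (v : U) (a b : ℝ)
    (h : ∀ w w', inner ℝ (A w) (A w') = a * (inner ℝ w w' + b * (inner ℝ v w * inner ℝ v w'))) :
    (A : U →ₗ[ℝ] E).normDet ^ 2 = a ^ Module.finrank ℝ U * (1 + b * ‖v‖ ^ 2) := by
  set B := stdOrthonormalBasis ℝ U
  have h1 := (A : U →ₗ[ℝ] E).normDet_sq_eq_det_gram B
  have h2 : Matrix.gram ℝ (fun i => (A : U →ₗ[ℝ] E) (B i)) =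
      a • (1 + Matrix.replicateCol Unit (fun i => b * inner ℝ v (B i)) *
        Matrix.replicateRow Unit (fun i => inner ℝ v (B i))) := by
    ext i j
    simp only [Matrix.gram_apply, Matrix.smul_apply, Matrix.add_apply, Matrix.mul_apply,
      Matrix.replicateCol_apply, Matrix.replicateRow_apply, Finset.univ_unique,
      Finset.sum_singleton, smul_eq_mul, ContinuousLinearMap.coe_coe, h,
      orthonormal_iff_ite.1 B.orthonormal i j, Matrix.one_apply]
    ring
  have h3 : (fun i => inner ℝ v (B i)) ⬝ᵥ (fun i => b * inner ℝ v (B i)) = b * ‖v‖ ^ 2 := by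
    rw [← B.sum_sq_norm_inner_left v, Finset.mul_sum]
    refine Finset.sum_congr rfl fun i _ => ?_
    rw [Real.norm_eq_abs, sq_abs]; ring
  rw [h2, Matrix.det_smul, Matrix.det_one_add_replicateCol_mul_replicateRow, h3,
    Fintype.card_fin] at h1
  exact h1

theorem hasFDerivAt_invHypot (y : U) :
    HasFDerivAt invHypot (-(invHypot y ^ 3) • innerSL ℝ y) y := by
  have h1 : HasFDerivAt (fun y : U => 1 + ‖y‖ ^ 2) (2 • innerSL ℝ y) y :=
    (hasStrictFDerivAt_norm_sq y).hasFDerivAt.const_add 1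
  have hpos : (0 : ℝ) < 1 + ‖y‖ ^ 2 := by positivity
  have h2 := ((Real.hasDerivAt_sqrt hpos.ne').inv (Real.sqrt_pos.2 hpos).ne').comp_hasFDerivAt y h1
  refine h2.congr_fderiv ?_
  ext w
  have hs : √(1 + ‖y‖ ^ 2) ≠ 0 := (Real.sqrt_pos.2 hpos).ne'
  simp only [invHypot, _root_.smul_apply, smul_eq_mul, nsmul_eq_mul,
    Nat.cast_ofNat, innerSL_apply_apply]
  field_simp

/-- The inverse of the central projection of a half sphere of radius `r` with center `x₀` and
pole `x₀ + r e` to the hyperplane spanned by the range of `L`. -/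
noncomputable def gnomonic (L : U →ₗᵢ[ℝ] E) (e x₀ : E) (r : ℝ) (y : U) : E :=
  x₀ + (r * invHypot y) • (L y + e)

/-- The derivative of `gnomonic`. -/
noncomputable def gnomonicDeriv (L : U →ₗᵢ[ℝ] E) (e : E) (r : ℝ) (y : U) : U →L[ℝ] E :=
  (r * invHypot y) • L.toContinuousLinearMap +
    (-(r * invHypot y ^ 3)) • (innerSL ℝ y).smulRight (L y + e)

variable (L : U →ₗᵢ[ℝ] E) {e : E} (x₀ : E) {r : ℝ}

theorem continuous_gnomonic : Continuous (gnomonic L e x₀ r) := by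
  unfold gnomonic
  have := continuous_invHypot (U := U)
  have := L.continuous
  fun_prop

theorem continuous_gnomonicDeriv : Continuous (gnomonicDeriv L e r) := by
  unfold gnomonicDeriv
  have := continuous_invHypot (U := U)
  have h2 := L.continuous
  have h3 : Continuous fun y : U => (innerSL ℝ y).smulRight (L y + e) := by
    have h4 : Continuous fun y : U => innerSL ℝ y := (innerSL ℝ).continuous
    exact (ContinuousLinearMap.smulRightL ℝ U E).continuous₂.comp
      (h4.prodMk (h2.add continuous_const))
  fun_prop

theorem hasFDerivAt_gnomonic (y : U) :
    HasFDerivAt (gnomonic L e x₀ r) (gnomonicDeriv L e r y) y := by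
  have h1 := ((hasFDerivAt_invHypot y).const_mul r).smul
    (L.toContinuousLinearMap.hasFDerivAt.add_const e (x := y))
  refine (h1.const_add x₀).congr_fderiv ?_
  ext w
  simp only [gnomonicDeriv, _root_.add_apply, _root_.smul_apply,
    ContinuousLinearMap.smulRight_apply, LinearIsometry.coe_toContinuousLinearMap, smul_eq_mul,
    innerSL_apply_apply, smul_smul]
  congr 2
  ring

theorem normDet_gnomonicDeriv [FiniteDimensional ℝ U] (he : ‖e‖ = 1)
    (hLe : ∀ y, inner ℝ (L y) e = 0) (hr : 0 ≤ r) (y : U) :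
    (gnomonicDeriv L e r y : U →ₗ[ℝ] E).normDet =
      r ^ Module.finrank ℝ U * invHypot y ^ (Module.finrank ℝ U + 1) := by
  have hk := invHypot_sq y
  have hk0 := invHypot_pos y
  set k := invHypot y with hkdef
  have hee : inner ℝ e e = (1 : ℝ) := by rw [real_inner_self_eq_norm_sq, he, one_pow]
  have hLe' : ∀ y, inner ℝ e (L y) = (0 : ℝ) := fun y => by rw [real_inner_comm, hLe]
  have h := normDet_sq_of_inner_eq (gnomonicDeriv L e r y) y (r ^ 2 * k ^ 2) (-(k ^ 2)) ?_
  · refine (sq_eq_sq₀ (LinearMap.normDet_nonneg _) (by positivity)).1 ?_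
    rw [h]
    have : 1 + -(k ^ 2) * ‖y‖ ^ 2 = k ^ 2 := by linarith
    rw [this]; ring
  · intro w w'
    simp only [gnomonicDeriv, _root_.add_apply, _root_.smul_apply,
      ContinuousLinearMap.smulRight_apply, LinearIsometry.coe_toContinuousLinearMap,
      innerSL_apply_apply, inner_add_left, inner_add_right, real_inner_smul_left,
      real_inner_smul_right, L.inner_map_map, hLe, hLe', hee, ← hkdef]
    rw [real_inner_self_eq_norm_sq, real_inner_comm y w]
    linear_combination (r ^ 2 * k ^ 4 * inner ℝ y w * inner ℝ y w') * hk

theorem inner_gnomonic_sub (he : ‖e‖ = 1) (hLe : ∀ y, inner ℝ (L y) e = 0)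
    (y : U) :
    inner ℝ (gnomonic L e x₀ r y - x₀) e = r * invHypot y := by
  rw [gnomonic, add_sub_cancel_left, real_inner_smul_left, inner_add_left, hLe,
    real_inner_self_eq_norm_sq, he]
  ring

theorem gnomonic_mem_sphere (he : ‖e‖ = 1) (hLe : ∀ y, inner ℝ (L y) e = 0)
    (hr : 0 ≤ r) (y : U) : gnomonic L e x₀ r y ∈ Metric.sphere x₀ r := by
  rw [mem_sphere_iff_norm, gnomonic, add_sub_cancel_left, norm_smul]
  have h : ‖L y + e‖ ^ 2 = 1 + ‖y‖ ^ 2 := by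
    rw [norm_add_sq_real, hLe, L.norm_map, he]; ring
  have hk := invHypot_pos y
  refine (sq_eq_sq₀ (by positivity) hr).1 ?_
  rw [mul_pow, h, Real.norm_eq_abs, sq_abs, mul_pow, mul_assoc, invHypot_sq, mul_one]

theorem injective_gnomonic (he : ‖e‖ = 1) (hLe : ∀ y, inner ℝ (L y) e = 0)
    (hr : 0 < r) : Injective (gnomonic L e x₀ r) := by
  intro y y' h
  have h1 := inner_gnomonic_sub L x₀ (r := r) he hLe y
  rw [h, inner_gnomonic_sub L x₀ he hLe] at h1
  have hk := invHypot_pos y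
  have h2 := add_left_cancel (show x₀ + _ = x₀ + _ from h)
  rw [h1] at h2
  exact L.injective (add_right_cancel (smul_right_injective E (by positivity) h2))

variable [FiniteDimensional ℝ U] [FiniteDimensional ℝ E] [MeasurableSpace U] [BorelSpace U]
  [MeasurableSpace E] [BorelSpace E]

theorem euclideanHausdorffMeasure_gnomonic_image (he : ‖e‖ = 1) (hLe : ∀ y, inner ℝ (L y) e = 0)
    (hr : 0 < r) {s : Set U} (hs : MeasurableSet s) :
    μHE[Module.finrank ℝ U] (gnomonic L e x₀ r '' s) = ∫⁻ y in s,
      ENNReal.ofReal (r ^ Module.finrank ℝ U * invHypot y ^ (Module.finrank ℝ U + 1)) := by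
  rw [euclideanHausdorffMeasure_image_eq_lintegral_normDet hs
    (fun x _ => (hasFDerivAt_gnomonic L x₀ x).hasFDerivWithinAt)
    (continuous_gnomonicDeriv L).measurable (fun x _ => ?_)
    (injective_gnomonic L x₀ he hLe hr).injOn]
  · simp_rw [normDet_gnomonicDeriv L he hLe hr.le]
  · have := normDet_gnomonicDeriv L he hLe hr.le x
    have hk := invHypot_pos x
    refine ((gnomonicDeriv L e r x : U →ₗ[ℝ] E).normDet_ne_zero_tfae.out 0 4).1 ?_
    rw [this]
    positivity

end Gnomonic

section Sphere

variable {d : ℕ}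

/-- The area of a unit half sphere in `ℝᵈ⁺¹`, as an integral in gnomonic coordinates. -/
noncomputable def halfSphereArea (d : ℕ) : ℝ≥0∞ :=
  ∫⁻ y : EuclideanSpace ℝ (Fin d), ENNReal.ofReal (invHypot y ^ (d + 1))

/-- Every unit vector is the normal of an isometrically embedded hyperplane. -/
theorem exists_linearIsometry_orthogonal {e : EuclideanSpace ℝ (Fin (d + 1))} (he : ‖e‖ = 1) :
    ∃ L : EuclideanSpace ℝ (Fin d) →ₗᵢ[ℝ] EuclideanSpace ℝ (Fin (d + 1)),
      ∀ y, inner ℝ (L y) e = 0 := by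
  have : Fact (Module.finrank ℝ (EuclideanSpace ℝ (Fin (d + 1))) = d + 1) := ⟨by simp⟩
  have he0 : e ≠ 0 := by rintro rfl; simp at he
  set B := OrthonormalBasis.fromOrthogonalSpanSingleton (𝕜 := ℝ) d he0
  refine ⟨(Submodule.subtypeₗᵢ _).comp B.repr.symm.toLinearIsometry, fun y => ?_⟩
  have := (B.repr.symm y).2
  rw [Submodule.mem_orthogonal_singleton_iff_inner_left] at this
  exact this

/-- The two open half spheres have at least the expected area; the equator is left out. -/
theorem two_mul_halfSphereArea_le (x₀ : EuclideanSpace ℝ (Fin (d + 1))) {r : ℝ} (hr : 0 < r) :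
    2 * (ENNReal.ofReal (r ^ d) * halfSphereArea d) ≤ μHE[d] (Metric.sphere x₀ r) := by
  set e : EuclideanSpace ℝ (Fin (d + 1)) := EuclideanSpace.single 0 1
  have he : ‖e‖ = 1 := by simp [e]
  obtain ⟨L, hL⟩ := exists_linearIsometry_orthogonal he
  have he' : ‖-e‖ = 1 := by rwa [norm_neg]
  have hL' : ∀ y, inner ℝ (L y) (-e) = 0 := fun y => by rw [inner_neg_right, hL, neg_zero]
  have harea : ∀ e' : EuclideanSpace ℝ (Fin (d + 1)), ‖e'‖ = 1 → (∀ y, inner ℝ (L y) e' = 0) →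
      μHE[d] (range (gnomonic L e' x₀ r)) = ENNReal.ofReal (r ^ d) * halfSphereArea d := by
    intro e' he' hL'
    have := euclideanHausdorffMeasure_gnomonic_image L x₀ he' hL' hr MeasurableSet.univ
    rw [finrank_euclideanSpace_fin, image_univ] at this
    rw [this, halfSphereArea, ← lintegral_const_mul' _ _ ENNReal.ofReal_ne_top,
      Measure.restrict_univ]
    simp_rw [ENNReal.ofReal_mul (pow_nonneg hr.le d)]
  have hdisj : Disjoint (range (gnomonic L e x₀ r)) (range (gnomonic L (-e) x₀ r)) := by
    rw [Set.disjoint_left]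
    rintro _ ⟨y, rfl⟩ ⟨y', hy'⟩
    have h1 := inner_gnomonic_sub L x₀ (r := r) he hL y
    have h2 := inner_gnomonic_sub L x₀ (r := r) he' hL' y'
    rw [hy', inner_neg_right, h1] at h2
    have := mul_pos hr (invHypot_pos y)
    have := mul_pos hr (invHypot_pos y')
    linarith
  have hmeas : MeasurableSet (range (gnomonic L (-e) x₀ r)) := by
    rw [← image_univ]
    exact MeasurableSet.univ.image_of_continuousOn_injOn (continuous_gnomonic L x₀).continuousOn
      (injective_gnomonic L x₀ he' hL' hr).injOn
  rw [two_mul]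
  calc _ = μHE[d] (range (gnomonic L e x₀ r)) + μHE[d] (range (gnomonic L (-e) x₀ r)) := by
        rw [harea e he hL, harea (-e) he' hL']
    _ = μHE[d] (range (gnomonic L e x₀ r) ∪ range (gnomonic L (-e) x₀ r)) :=
        (measure_union hdisj hmeas).symm
    _ ≤ _ := by
        refine measure_mono (union_subset ?_ ?_)
        · rintro _ ⟨y, rfl⟩; exact gnomonic_mem_sphere L x₀ he hL hr.le y
        · rintro _ ⟨y, rfl⟩; exact gnomonic_mem_sphere L x₀ he' hL' hr.le y

/-- Nonempty relatively open subsets of a sphere have positive area. -/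
theorem euclideanHausdorffMeasure_sphere_inter_pos {x₀ p : EuclideanSpace ℝ (Fin (d + 1))}
    {r : ℝ} (hr : 0 < r) {O : Set (EuclideanSpace ℝ (Fin (d + 1)))} (hO : IsOpen O)
    (hp : p ∈ Metric.sphere x₀ r) (hpO : p ∈ O) : 0 < μHE[d] (Metric.sphere x₀ r ∩ O) := by
  set e : EuclideanSpace ℝ (Fin (d + 1)) := r⁻¹ • (p - x₀) with hedef
  have he : ‖e‖ = 1 := by
    rw [hedef, norm_smul, mem_sphere_iff_norm.1 hp, norm_inv, Real.norm_of_nonneg hr.le,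
      inv_mul_cancel₀ hr.ne']
  obtain ⟨L, hL⟩ := exists_linearIsometry_orthogonal he
  set s := gnomonic L e x₀ r ⁻¹' O with hs
  have hsO : IsOpen s := hO.preimage (continuous_gnomonic L x₀)
  have h0 : (0 : EuclideanSpace ℝ (Fin d)) ∈ s := by
    have : gnomonic L e x₀ r 0 = p := by
      simp [gnomonic, invHypot, hedef, smul_smul, mul_inv_cancel₀ hr.ne']
    rw [hs, mem_preimage, this]; exact hpO
  have harea := euclideanHausdorffMeasure_gnomonic_image L x₀ he hL hr hsO.measurableSet
  rw [finrank_euclideanSpace_fin] at harea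
  have hle : μHE[d] (gnomonic L e x₀ r '' s) ≤ μHE[d] (Metric.sphere x₀ r ∩ O) := by
    refine measure_mono ?_
    rintro _ ⟨y, hy, rfl⟩
    exact ⟨gnomonic_mem_sphere L x₀ he hL hr.le y, hy⟩
  refine lt_of_lt_of_le ?_ hle
  rw [harea, setLIntegral_pos_iff]
  · have : (support fun y : EuclideanSpace ℝ (Fin d) =>
        ENNReal.ofReal (r ^ d * invHypot y ^ (d + 1))) = univ := by
      ext y
      have := invHypot_pos y
      simp only [mem_support, mem_univ, iff_true, ne_eq, ENNReal.ofReal_eq_zero, not_le]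
      positivity
    rw [this, univ_inter]
    exact hsO.measure_pos _ ⟨0, h0⟩
  · have := continuous_invHypot (U := EuclideanSpace ℝ (Fin d))
    fun_prop

end Sphere

/-! ### Radial projection of the boundary to the inscribed sphere -/

section RadialProjection

variable {E : Type*} [NormedAddCommGroup E] [InnerProductSpace ℝ E]

/-- The radial projection onto the sphere with center `x₀` and radius `r`; the center itself is
kept fixed. -/
noncomputable def radialProjection (x₀ : E) (r : ℝ) (x : E) : E :=
  x₀ + (r / ‖x - x₀‖) • (x - x₀)

theorem radialProjection_ray {x₀ u : E} {r t : ℝ} (hr : 0 < r) (hu : ‖u‖ = r) (ht : 0 < t) :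
    radialProjection x₀ r (x₀ + t • u) = x₀ + u := by
  rw [radialProjection, add_sub_cancel_left, norm_smul, hu, Real.norm_of_nonneg ht.le, smul_smul,
    show r / (t * r) * t = 1 by field_simp, one_smul]

/-- Outside the ball of radius `R`, the radial projection contracts distances by `r / R`. -/
theorem dist_radialProjection_le {x₀ x y : E} {r R : ℝ} (hr : 0 ≤ r) (hR : 0 < R)
    (hx : R ≤ ‖x - x₀‖) (hy : R ≤ ‖y - x₀‖) :
    dist (radialProjection x₀ r x) (radialProjection x₀ r y) ≤ r / R * dist x y := by
  set u := x - x₀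
  set v := y - x₀
  have hu0 : 0 < ‖u‖ := hR.trans_le hx
  have hv0 : 0 < ‖v‖ := hR.trans_le hy
  have h1 : dist (radialProjection x₀ r x) (radialProjection x₀ r y) =
      r * ‖(‖u‖⁻¹ : ℝ) • u - (‖v‖⁻¹ : ℝ) • v‖ := by
    rw [radialProjection, radialProjection, dist_add_left, dist_eq_norm, div_eq_mul_inv,
      div_eq_mul_inv, mul_smul, mul_smul, ← smul_sub, norm_smul, Real.norm_of_nonneg hr]
  have h2 : dist x y = ‖u - v‖ := by rw [dist_eq_norm]; congr 1; simp [u, v]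
  have h3 : R * ‖(‖u‖⁻¹ : ℝ) • u - (‖v‖⁻¹ : ℝ) • v‖ ≤ ‖u - v‖ := by
    refine (sq_le_sq₀ (by positivity) (by positivity)).1 ?_
    have hn : ∀ w : E, 0 < ‖w‖ → ‖(‖w‖⁻¹ : ℝ) • w‖ = 1 := fun w hw => by
      rw [norm_smul, norm_inv, norm_norm, inv_mul_cancel₀ hw.ne']
    rw [mul_pow, norm_sub_sq_real, norm_sub_sq_real, hn u hu0, hn v hv0, real_inner_smul_left,
      real_inner_smul_right]
    -- both sides are expressed through `‖u‖`, `‖v‖` and the cosine of the angle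
    set c := ‖u‖⁻¹ * (‖v‖⁻¹ * inner ℝ u v) with hc
    have hin : inner ℝ u v = ‖u‖ * ‖v‖ * c := by rw [hc]; field_simp
    have hc1 : c ≤ 1 := by
      have := real_inner_le_norm u v
      rw [hin] at this
      exact le_of_mul_le_mul_left (by linarith) (mul_pos hu0 hv0)
    rw [hin]
    have h4 : R ^ 2 ≤ ‖u‖ * ‖v‖ := by rw [sq]; exact mul_le_mul hx hy hR.le hu0.le
    nlinarith [sq_nonneg (‖u‖ - ‖v‖), mul_le_mul_of_nonneg_right h4 (sub_nonneg.2 hc1)]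
  rw [h1, h2, div_mul_eq_mul_div, le_div_iff₀ hR]
  calc _ = r * (R * ‖(‖u‖⁻¹ : ℝ) • u - (‖v‖⁻¹ : ℝ) • v‖) := by ring
    _ ≤ _ := by gcongr

/-- A preconnected set that meets an open set and its complement meets its frontier. -/
theorem IsPreconnected.exists_mem_frontier {X : Type*} [TopologicalSpace X] {t Ω : Set X}
    (ht : IsPreconnected t) (hΩ : IsOpen Ω) (h : (t ∩ Ω).Nonempty) (h' : (t ∩ Ωᶜ).Nonempty) :
    (t ∩ frontier Ω).Nonempty := by
  by_contra hne
  have hcov : t ⊆ Ω ∪ (closure Ω)ᶜ := by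
    intro x hx
    by_contra hx'
    rw [mem_union, not_or, notMem_compl_iff] at hx'
    exact hne ⟨x, hx, by rw [hΩ.frontier_eq]; exact ⟨hx'.2, hx'.1⟩⟩
  obtain ⟨y, hyt, hy⟩ := h'
  have hy' : y ∈ (closure Ω)ᶜ := (hcov hyt).resolve_left hy
  obtain ⟨x, -, hx, hx'⟩ := ht Ω (closure Ω)ᶜ hΩ isClosed_closure.isOpen_compl hcov h ⟨y, hyt, hy'⟩
  exact hx' (subset_closure hx)

/-- A ray that starts in a bounded open set leaves it through its frontier. -/
theorem exists_ray_mem_frontier {Ω : Set E} (hΩo : IsOpen Ω) (hΩ : Bornology.IsBounded Ω)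
    {x₀ u : E} (hu : u ≠ 0) {s : ℝ} (hs : x₀ + s • u ∈ Ω) : ∃ t, s ≤ t ∧ x₀ + t • u ∈ frontier Ω := by
  have hpre : IsPreconnected ((fun t : ℝ => x₀ + t • u) '' Ici s) :=
    isPreconnected_Ici.image _ (by fun_prop)
  obtain ⟨C, hC⟩ := hΩ.exists_norm_le
  have hu' : 0 < ‖u‖ := norm_pos_iff.2 hu
  have hout : ((fun t : ℝ => x₀ + t • u) '' Ici s ∩ Ωᶜ).Nonempty := by
    set T := max (max s 0) ((C + ‖x₀‖ + 1) / ‖u‖) with hT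
    refine ⟨x₀ + T • u, ⟨T, mem_Ici.2 ((le_max_left s 0).trans (le_max_left _ _)), rfl⟩,
      fun hmem => ?_⟩
    have h1 := hC _ hmem
    have h2 : ‖T • u‖ ≤ ‖x₀ + T • u‖ + ‖x₀‖ := by
      have := norm_sub_le (x₀ + T • u) x₀
      rwa [add_sub_cancel_left] at this
    have h3 : (C + ‖x₀‖ + 1) / ‖u‖ ≤ T := le_max_right _ _
    have h4 : 0 ≤ T := (le_max_right _ _).trans (le_max_left _ _)
    rw [div_le_iff₀ hu'] at h3
    rw [norm_smul, Real.norm_of_nonneg h4] at h2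
    linarith
  obtain ⟨_, ⟨t, ht, rfl⟩, hfr⟩ := hpre.exists_mem_frontier hΩo
    ⟨x₀ + s • u, ⟨s, self_mem_Ici, rfl⟩, hs⟩ hout
  exact ⟨t, ht, hfr⟩

/-- A ball inscribed in a larger bounded open set has strictly smaller boundary area, if the
boundary area of the larger set is finite: the radial projection of the larger boundary covers the
sphere, and strictly contracts the part of it over an open subset. -/
theorem euclideanHausdorffMeasure_sphere_lt_frontier {d : ℕ} (hd : d ≠ 0)
    {Ω : Set (EuclideanSpace ℝ (Fin (d + 1)))} (hΩo : IsOpen Ω) (hΩb : Bornology.IsBounded Ω)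
    (hfin : μHE[d] (frontier Ω) ≠ ∞) {x₀ q : EuclideanSpace ℝ (Fin (d + 1))} {r : ℝ} (hr : 0 < r)
    (hball : Metric.ball x₀ r ⊆ Ω) (hq : q ∈ Ω) (hrq : r < ‖q - x₀‖) :
    μHE[d] (Metric.sphere x₀ r) < μHE[d] (frontier Ω) := by
  set R := ‖q - x₀‖ with hR
  have hR0 : 0 < R := hr.trans hrq
  set π := radialProjection x₀ r with hπ
  -- the directions in which `Ω` reaches out to the distance `R > r` of `q`
  set O : Set (EuclideanSpace ℝ (Fin (d + 1))) := {p | x₀ + (R / r) • (p - x₀) ∈ Ω} with hO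
  have hOo : IsOpen O := hΩo.preimage (by fun_prop)
  have hπm : Measurable π := by
    rw [hπ]; unfold radialProjection; fun_prop
  have hfrontier : ∀ x ∈ frontier Ω, r ≤ ‖x - x₀‖ := by
    intro x hx
    by_contra! h
    rw [hΩo.frontier_eq] at hx
    exact hx.2 (hball (mem_ball_iff_norm.2 h))
  set F₁ := frontier Ω ∩ π ⁻¹' O
  set F₂ := frontier Ω \ π ⁻¹' O
  have hF : μHE[d] F₁ + μHE[d] F₂ = μHE[d] (frontier Ω) :=
    measure_inter_add_sdiff _ (hπm hOo.measurableSet)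
  have hS : μHE[d] (Metric.sphere x₀ r ∩ O) + μHE[d] (Metric.sphere x₀ r \ O) =
      μHE[d] (Metric.sphere x₀ r) := measure_inter_add_sdiff _ hOo.measurableSet
  set κ : ℝ≥0 := (r / R).toNNReal with hκ
  have hκr : (κ : ℝ) = r / R := Real.coe_toNNReal _ (by positivity)
  have hκ1 : κ < 1 := by
    rw [← NNReal.coe_lt_coe, hκr, NNReal.coe_one, div_lt_one hR0]; exact hrq
  have h1 : μHE[d] (Metric.sphere x₀ r ∩ O) ≤ (κ : ℝ≥0∞) ^ d * μHE[d] F₁ := by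
    have hcov : Metric.sphere x₀ r ∩ O ⊆ π '' (F₁ ∩ {x | R ≤ ‖x - x₀‖}) := by
      rintro p ⟨hp, hpO⟩
      have hu : ‖p - x₀‖ = r := mem_sphere_iff_norm.1 hp
      obtain ⟨t, ht, htf⟩ := exists_ray_mem_frontier hΩo hΩb
        (norm_pos_iff.1 (hr.trans_eq hu.symm)) hpO
      have ht0 : 0 < t := (div_pos hR0 hr).trans_le ht
      have hπp : π (x₀ + t • (p - x₀)) = p := by
        rw [hπ, radialProjection_ray hr hu ht0, add_sub_cancel]
      refine ⟨_, ⟨⟨htf, ?_⟩, ?_⟩, hπp⟩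
      · rw [mem_preimage, hπp]; exact hpO
      · rw [mem_ofPred_eq, add_sub_cancel_left, norm_smul, hu, Real.norm_of_nonneg ht0.le]
        rwa [div_le_iff₀ hr] at ht
    refine (measure_mono hcov).trans ?_
    have := euclideanHausdorffMeasure_image_le_of_dist_le (f := id) (g := π)
      (s := F₁ ∩ {x | R ≤ ‖x - x₀‖}) (K := κ) d fun x hx y hy => by
        rw [hκr]; exact dist_radialProjection_le hr.le hR0 hx.2 hy.2
    rw [image_id] at this
    refine this.trans ?_
    gcongr
    exact inter_subset_left
  have h2 : μHE[d] (Metric.sphere x₀ r \ O) ≤ μHE[d] F₂ := by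
    have hcov : Metric.sphere x₀ r \ O ⊆ π '' F₂ := by
      rintro p ⟨hp, hpO⟩
      have hu : ‖p - x₀‖ = r := mem_sphere_iff_norm.1 hp
      obtain ⟨t, ht, htf⟩ := exists_ray_mem_frontier hΩo hΩb (s := 0) (x₀ := x₀)
        (norm_pos_iff.1 (hr.trans_eq hu.symm))
        (by rw [zero_smul, add_zero]; exact hball (Metric.mem_ball_self hr))
      have ht0 : 0 < t := by
        refine lt_of_le_of_ne ht fun h0 => ?_
        have := hfrontier _ htf
        rw [← h0, zero_smul, add_zero, sub_self, norm_zero] at this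
        linarith
      have hπp : π (x₀ + t • (p - x₀)) = p := by
        rw [hπ, radialProjection_ray hr hu ht0, add_sub_cancel]
      refine ⟨_, ⟨htf, ?_⟩, hπp⟩
      rw [mem_preimage, hπp]; exact hpO
    refine (measure_mono hcov).trans ?_
    have := euclideanHausdorffMeasure_image_le_of_dist_le (f := id) (g := π)
      (s := F₂) (K := 1) d fun x hx y hy => by
        have := dist_radialProjection_le hr.le hr (hfrontier x hx.1) (hfrontier y hy.1)
        rwa [div_self hr.ne'] at this
    simpa using this
  have hpos : 0 < μHE[d] (Metric.sphere x₀ r ∩ O) := by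
    have hray : q - x₀ = (R / r) • ((r / R) • (q - x₀)) := by
      rw [smul_smul, div_mul_div_cancel₀ hr.ne', div_self hR0.ne', one_smul]
    refine euclideanHausdorffMeasure_sphere_inter_pos (p := x₀ + (r / R) • (q - x₀)) hr hOo ?_ ?_
    · rw [mem_sphere_iff_norm, add_sub_cancel_left, norm_smul, ← hR,
        Real.norm_of_nonneg (by positivity), div_mul_cancel₀ _ hR0.ne']
    · rw [hO, mem_ofPred_eq, add_sub_cancel_left, ← hray, add_sub_cancel]; exact hq
  have hF₁ : μHE[d] F₁ ≠ ∞ := ne_top_of_le_ne_top hfin (measure_mono inter_subset_left)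
  have hF₂ : μHE[d] F₂ ≠ ∞ := ne_top_of_le_ne_top hfin (measure_mono sdiff_subset)
  have hF₁0 : μHE[d] F₁ ≠ 0 := by
    intro h0
    rw [h0, mul_zero] at h1
    exact absurd h1 (not_le.2 hpos)
  have hκd : (κ : ℝ≥0∞) ^ d < 1 := by
    exact_mod_cast pow_lt_one₀ zero_le hκ1 hd
  rw [← hS, ← hF]
  calc _ ≤ (κ : ℝ≥0∞) ^ d * μHE[d] F₁ + μHE[d] F₂ := add_le_add h1 h2
    _ < 1 * μHE[d] F₁ + μHE[d] F₂ :=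
      ENNReal.add_lt_add_right hF₂ (ENNReal.mul_lt_mul_left hF₁0 hF₁ hκd)
    _ = _ := by rw [one_mul]

end RadialProjection

/-! ### Harmonicity of the Poisson kernel -/

section PoissonKernel

open InnerProductSpace Laplacian

variable {E : Type*} [NormedAddCommGroup E] [InnerProductSpace ℝ E]

/-- The Poisson kernel of the ball with center `x₀` and the point `ζ` on its boundary, up to a
constant factor, as a function on the whole space. -/
noncomputable def poissonKernelAt (x₀ ζ x : E) : ℝ :=
  (‖ζ - x₀‖ ^ 2 - ‖x - x₀‖ ^ 2) * (‖x - ζ‖ ^ 2) ^ (-(Module.finrank ℝ E : ℝ) / 2)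

theorem hasFDerivAt_norm_sub_sq (c x : E) :
    HasFDerivAt (fun x : E => ‖x - c‖ ^ 2) ((2 : ℝ) • innerSL ℝ (x - c)) x := by
  refine ((hasFDerivAt_id x).sub_const c).norm_sq.congr_fderiv ?_
  ext w
  simp [two_smul]

theorem hasFDerivAt_norm_sub_sq_rpow {c x : E} (hx : x ≠ c) (b : ℝ) :
    HasFDerivAt (fun x : E => (‖x - c‖ ^ 2) ^ b)
      ((b * (‖x - c‖ ^ 2) ^ (b - 1)) • (2 : ℝ) • innerSL ℝ (x - c)) x :=
  (hasFDerivAt_norm_sub_sq c x).rpow_const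
    (Or.inl (pow_ne_zero 2 (norm_ne_zero_iff.2 (sub_ne_zero.2 hx))))

theorem contDiffAt_poissonKernelAt {x₀ ζ x : E} (hx : x ≠ ζ) :
    ContDiffAt ℝ 2 (poissonKernelAt x₀ ζ) x := by
  unfold poissonKernelAt
  have h1 : ContDiffAt ℝ 2 (fun x : E => ‖x - ζ‖ ^ 2) x :=
    (contDiffAt_id.sub contDiffAt_const).norm_sq ℝ
  have h2 : ContDiffAt ℝ 2 (fun x : E => ‖x - x₀‖ ^ 2) x :=
    (contDiffAt_id.sub contDiffAt_const).norm_sq ℝ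
  exact (contDiffAt_const.sub h2).mul
    (h1.rpow_const_of_ne (pow_ne_zero 2 (norm_ne_zero_iff.2 (sub_ne_zero.2 hx))))

/-- Directional derivatives of the kernel. -/
theorem fderiv_poissonKernelAt_apply {x₀ ζ x : E} (hx : x ≠ ζ) (v : E) {b : ℝ}
    (hb : b = -(Module.finrank ℝ E : ℝ) / 2) :
    fderiv ℝ (poissonKernelAt x₀ ζ) x v =
      (‖ζ - x₀‖ ^ 2 - ‖x - x₀‖ ^ 2) * (b * (‖x - ζ‖ ^ 2) ^ (b - 1)) * (2 * inner ℝ (x - ζ) v) -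
        (‖x - ζ‖ ^ 2) ^ b * (2 * inner ℝ (x - x₀) v) := by
  have h := ((hasFDerivAt_norm_sub_sq x₀ x).const_sub (‖ζ - x₀‖ ^ 2)).mul
    (hasFDerivAt_norm_sub_sq_rpow hx b)
  subst hb
  rw [show fderiv ℝ (poissonKernelAt x₀ ζ) x = _ from h.fderiv]
  simp only [_root_.add_apply, _root_.smul_apply, _root_.neg_apply, smul_eq_mul,
    innerSL_apply_apply]
  ring

/-- Second directional derivatives of the kernel, written in terms of `w = x - ζ` and
`p = ζ - x₀`. -/
theorem iteratedFDeriv_two_poissonKernelAt {x₀ ζ x : E} (hx : x ≠ ζ) {v : E} (hv : ‖v‖ = 1) {b : ℝ}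
    (hb : b = -(Module.finrank ℝ E : ℝ) / 2) :
    iteratedFDeriv ℝ 2 (poissonKernelAt x₀ ζ) x ![v, v] =
      -(2 * (‖x - ζ‖ ^ 2) ^ b
        + 8 * b * (‖x - ζ‖ ^ 2) ^ (b - 1) *
          (inner ℝ (x - ζ) v * inner ℝ (x - ζ) v + inner ℝ (ζ - x₀) v * inner ℝ (x - ζ) v)
        + (‖x - ζ‖ ^ 2 + 2 * inner ℝ (x - ζ) (ζ - x₀)) * (2 * b * (‖x - ζ‖ ^ 2) ^ (b - 1)
          + 4 * b * (b - 1) * (‖x - ζ‖ ^ 2) ^ (b - 1 - 1) *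
            (inner ℝ (x - ζ) v * inner ℝ (x - ζ) v))) := by
  have hC := contDiffAt_poissonKernelAt (x₀ := x₀) hx
  have hd : DifferentiableAt ℝ (fderiv ℝ (poissonKernelAt x₀ ζ)) x :=
    (hC.fderiv_right (m := 1) (by norm_num)).differentiableAt one_ne_zero
  have h1 : fderiv ℝ (fderiv ℝ (poissonKernelAt x₀ ζ)) x v v =
      fderiv ℝ (fun y => fderiv ℝ (poissonKernelAt x₀ ζ) y v) x v := by
    rw [fderiv_clm_apply hd (differentiableAt_const v)]
    simp
  have h2 : (fun y => fderiv ℝ (poissonKernelAt x₀ ζ) y v) =ᶠ[𝓝 x] fun x =>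
      (‖ζ - x₀‖ ^ 2 - ‖x - x₀‖ ^ 2) * (b * (‖x - ζ‖ ^ 2) ^ (b - 1)) * (2 * inner ℝ (x - ζ) v) -
        (‖x - ζ‖ ^ 2) ^ b * (2 * inner ℝ (x - x₀) v) := by
    filter_upwards [isOpen_ne.mem_nhds hx] with y hy
    exact fderiv_poissonKernelAt_apply hy v hb
  have hin : ∀ c : E, HasFDerivAt (fun x : E => 2 * inner ℝ (x - c) v)
      ((2 : ℝ) • innerSL ℝ v) x := by
    intro c
    have := ((innerSL ℝ v).hasFDerivAt.comp x ((hasFDerivAt_id x).sub_const c)).const_mul 2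
    refine (this.congr_fderiv (by ext; simp)).congr_of_eventuallyEq
      (Eventually.of_forall fun y => ?_)
    simp [real_inner_comm]
  have h3 := ((((hasFDerivAt_norm_sub_sq x₀ x).const_sub (‖ζ - x₀‖ ^ 2)).mul
    ((hasFDerivAt_norm_sub_sq_rpow hx (b - 1)).const_mul b)).mul (hin ζ)).sub
    ((hasFDerivAt_norm_sub_sq_rpow hx b).mul (hin x₀))
  rw [iteratedFDeriv_two_apply]
  simp only [Matrix.cons_val_zero, Matrix.cons_val_one]
  rw [h1, h2.fderiv_eq]
  have h4 : fderiv ℝ (fun x => (‖ζ - x₀‖ ^ 2 - ‖x - x₀‖ ^ 2) * (b * (‖x - ζ‖ ^ 2) ^ (b - 1)) *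
      (2 * inner ℝ (x - ζ) v) - (‖x - ζ‖ ^ 2) ^ b * (2 * inner ℝ (x - x₀) v)) x = _ := h3.fderiv
  rw [h4]
  simp only [_root_.add_apply, _root_.sub_apply, _root_.smul_apply, _root_.neg_apply, smul_eq_mul,
    innerSL_apply_apply, real_inner_self_eq_norm_sq, hv, Pi.mul_apply]
  have h5 : ‖x - x₀‖ ^ 2 = ‖x - ζ‖ ^ 2 + 2 * inner ℝ (x - ζ) (ζ - x₀) + ‖ζ - x₀‖ ^ 2 := by
    rw [← norm_add_sq_real, sub_add_sub_cancel]
  have h6 : inner ℝ (x - x₀) v = inner ℝ (x - ζ) v + inner ℝ (ζ - x₀) v := by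
    rw [← inner_add_left, sub_add_sub_cancel]
  rw [h5, h6]
  ring

variable [FiniteDimensional ℝ E]

theorem laplacian_poissonKernelAt {x₀ ζ x : E} (hx : x ≠ ζ) :
    Δ (poissonKernelAt x₀ ζ) x = 0 := by
  obtain ⟨b, hb⟩ : ∃ b, b = -(Module.finrank ℝ E : ℝ) / 2 := ⟨_, rfl⟩
  set B := stdOrthonormalBasis ℝ E
  rw [laplacian_eq_iteratedFDeriv_orthonormalBasis _ B]
  have h1 : ∀ i, iteratedFDeriv ℝ 2 (poissonKernelAt x₀ ζ) x ![B i, B i] = _ := fun i =>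
    iteratedFDeriv_two_poissonKernelAt hx (B.norm_eq_one i) hb
  simp only [h1]
  have hww : ∑ i, inner ℝ (x - ζ) (B i) * inner ℝ (x - ζ) (B i) = ‖x - ζ‖ ^ 2 := by
    rw [← real_inner_self_eq_norm_sq, ← B.sum_inner_mul_inner]
    exact Finset.sum_congr rfl fun i _ => by rw [real_inner_comm (x - ζ) (B i)]
  have hpw : ∑ i, inner ℝ (ζ - x₀) (B i) * inner ℝ (x - ζ) (B i) =
      inner ℝ (x - ζ) (ζ - x₀) := by
    rw [real_inner_comm, ← B.sum_inner_mul_inner]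
    exact Finset.sum_congr rfl fun i _ => by rw [real_inner_comm (x - ζ) (B i)]
  have hq : 0 < ‖x - ζ‖ ^ 2 := by
    have := norm_pos_iff.2 (sub_ne_zero.2 hx)
    positivity
  simp only [Finset.sum_neg_distrib, Finset.sum_add_distrib, ← Finset.mul_sum, hww, hpw,
    Finset.sum_const, Finset.card_univ, Fintype.card_fin, nsmul_eq_mul]
  set q := ‖x - ζ‖ ^ 2
  rw [show q ^ b = q * q ^ (b - 1) by rw [Real.rpow_sub_one hq.ne']; field_simp,
    show q ^ (b - 1) = q * q ^ (b - 1 - 1) by rw [Real.rpow_sub_one hq.ne' (b - 1)]; field_simp]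
  have hn : (Module.finrank ℝ E : ℝ) = -2 * b := by rw [hb]; ring
  rw [hn]
  ring

theorem harmonicAt_poissonKernelAt {x₀ ζ x : E} (hx : x ≠ ζ) :
    HarmonicAt (poissonKernelAt x₀ ζ) x := by
  refine ⟨contDiffAt_poissonKernelAt hx, ?_⟩
  filter_upwards [isOpen_ne.mem_nhds hx] with y hy
  exact laplacian_poissonKernelAt hy

theorem harmonicContOnCl_poissonKernelAt {x₀ ζ : E} {Ω : Set E} (h : ζ ∉ closure Ω) :
    HarmonicContOnCl (poissonKernelAt x₀ ζ) Ω :=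
  HarmonicOnNhd.harmonicContOnCl fun _ hx =>
    harmonicAt_poissonKernelAt fun heq => h (heq ▸ hx)

end PoissonKernel

/-! ### Integrals over Lipschitz flat graphs -/

section Graph

variable {U E : Type*} [NormedAddCommGroup U] [InnerProductSpace ℝ U]
  [NormedAddCommGroup E] [InnerProductSpace ℝ E]

/-- The graph of `ψ` over the hyperplane `range L`, with vertical direction `e`. -/
def graphMap (L : U →ₗᵢ[ℝ] E) (e : E) (ψ : U → ℝ) (y : U) : E := L y + ψ y • e

variable (L : U →ₗᵢ[ℝ] E) {e : E}

theorem norm_map_add_smul (he : ‖e‖ = 1) (hLe : ∀ y, inner ℝ (L y) e = 0)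
    (y : U) (t : ℝ) : ‖L y + t • e‖ = √(‖y‖ ^ 2 + t ^ 2) := by
  rw [← Real.sqrt_sq (norm_nonneg (L y + t • e)), norm_add_sq_real, real_inner_smul_right, hLe,
    L.norm_map, norm_smul, he, Real.norm_eq_abs, mul_one, sq_abs]
  ring_nf

theorem injective_graphMap (he : ‖e‖ = 1) (hLe : ∀ y, inner ℝ (L y) e = 0)
    (ψ : U → ℝ) : Injective (graphMap L e ψ) := by
  intro y y' h
  have h1 : L (y - y') + (ψ y - ψ y') • e = 0 := by
    rw [map_sub, sub_smul, sub_add_sub_comm]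
    exact sub_eq_zero.2 h
  have h2 := norm_map_add_smul L he hLe (y - y') (ψ y - ψ y')
  rw [h1, norm_zero, eq_comm, Real.sqrt_eq_zero (by positivity)] at h2
  have h3 : ‖y - y'‖ ^ 2 = 0 := by nlinarith [sq_nonneg (ψ y - ψ y'), sq_nonneg ‖y - y'‖]
  exact sub_eq_zero.1 (norm_eq_zero.1 (pow_eq_zero_iff two_ne_zero |>.1 h3))

variable [FiniteDimensional ℝ U] [MeasurableSpace U] [BorelSpace U]

theorem lintegral_comp_linearMap_add {M : U →ₗ[ℝ] U} (hM : M.det ≠ 0) (c : U) {f : U → ℝ≥0∞}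
    (hf : Measurable f) :
    ∫⁻ x, f (M x + c) = ENNReal.ofReal |M.det⁻¹| * ∫⁻ y, f y := by
  have hMm : Measurable M := (M.continuous_of_finiteDimensional).measurable
  have h1 : Measurable fun y => f (y + c) := hf.comp (measurable_add_const c)
  rw [← lintegral_map (f := fun y => f (y + c)) h1 hMm,
    Measure.map_linearMap_addHaar_eq_smul_addHaar _ hM, lintegral_smul_measure,
    lintegral_add_right_eq_self f c, smul_eq_mul]

/-- The solid angle under which the hyperplane with slope `v` through the origin is seen from the
point at height one above the origin: a half sphere, whatever the slope. Completing the square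
turns the distance to that point into a multiple of `√(1 + ‖y‖²)` in an affine coordinate `y`. -/
theorem lintegral_inv_norm_tilted (v : U) {n : ℕ} (hn : n = Module.finrank ℝ U + 1) :
    ∫⁻ ξ : U, ENNReal.ofReal ((√(‖ξ‖ ^ 2 + (inner ℝ v ξ - 1) ^ 2))⁻¹ ^ n) =
      ∫⁻ y : U, ENNReal.ofReal (invHypot y ^ n) := by
  set σ := √(1 + ‖v‖ ^ 2) with hσ
  have hσ2 : σ ^ 2 = 1 + ‖v‖ ^ 2 := Real.sq_sqrt (by positivity)
  have hσ0 : 0 < σ := Real.sqrt_pos.2 (by positivity)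
  -- the linear part of the new coordinate is `σ T`, `T` the positive square root of `1 + v ⊗ v`
  set c : ℝ := (σ + 1)⁻¹ with hc
  have hc1 : c * (σ + 1) = 1 := inv_mul_cancel₀ (by positivity)
  set M : U →L[ℝ] U := σ • (ContinuousLinearMap.id ℝ U + c • (innerSL ℝ v).smulRight v) with hM
  have hMapp : ∀ w, M w = σ • (w + (c * inner ℝ v w) • v) := by
    intro w; simp [hM, smul_smul, mul_assoc]
  have hc2 : 2 * c + c ^ 2 * ‖v‖ ^ 2 = 1 := by
    have : ‖v‖ ^ 2 = (σ - 1) * (σ + 1) := by linarith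
    rw [this]
    linear_combination (c * (σ - 1) + 1) * hc1
  have hinner : ∀ w w', inner ℝ (M w) (M w') =
      σ ^ 2 * (inner ℝ w w' + 1 * (inner ℝ v w * inner ℝ v w')) := by
    intro w w'
    rw [hMapp, hMapp]
    simp only [inner_add_left, inner_add_right, real_inner_smul_left, real_inner_smul_right,
      real_inner_self_eq_norm_sq]
    rw [real_inner_comm v w]
    linear_combination (σ ^ 2 * inner ℝ v w * inner ℝ v w') * hc2
  have hdet : |(M : U →ₗ[ℝ] U).det| = σ ^ n := by
    have h := normDet_sq_of_inner_eq M v _ _ hinner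
    rw [LinearMap.normDet_eq_abs_det] at h
    refine (sq_eq_sq₀ (abs_nonneg _) (by positivity)).1 ?_
    rw [h, one_mul, ← hσ2, hn]; ring
  have hdet0 : (M : U →ₗ[ℝ] U).det ≠ 0 := by
    rw [← abs_pos, hdet]; positivity
  have hMv : ∀ ξ, inner ℝ (M ξ) v = σ ^ 2 * inner ℝ v ξ := by
    intro ξ
    rw [hMapp, real_inner_smul_left, inner_add_left, real_inner_smul_left,
      real_inner_self_eq_norm_sq, real_inner_comm v ξ]
    have : ‖v‖ ^ 2 = (σ - 1) * (σ + 1) := by linarith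
    rw [this]
    linear_combination (σ * inner ℝ v ξ * (σ - 1)) * hc1
  have hQ : ∀ ξ, 1 + ‖(M : U →ₗ[ℝ] U) ξ + -v‖ ^ 2 =
      σ ^ 2 * (‖ξ‖ ^ 2 + (inner ℝ v ξ - 1) ^ 2) := by
    intro ξ
    rw [ContinuousLinearMap.coe_coe, ← sub_eq_add_neg, norm_sub_sq_real, hMv,
      ← real_inner_self_eq_norm_sq (M ξ), hinner, real_inner_self_eq_norm_sq]
    linear_combination -hσ2
  have hk : ∀ ξ, (√(‖ξ‖ ^ 2 + (inner ℝ v ξ - 1) ^ 2))⁻¹ =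
      σ * invHypot ((M : U →ₗ[ℝ] U) ξ + -v) := by
    intro ξ
    rw [invHypot, hQ, Real.sqrt_mul (by positivity), Real.sqrt_sq hσ0.le, mul_inv,
      mul_inv_cancel_left₀ hσ0.ne']
  have hmeas : Measurable fun y : U => ENNReal.ofReal (invHypot y ^ n) := by
    have := continuous_invHypot (U := U)
    fun_prop
  simp_rw [hk, mul_pow, ENNReal.ofReal_mul (pow_nonneg hσ0.le n)]
  rw [lintegral_const_mul' _ _ ENNReal.ofReal_ne_top,
    lintegral_comp_linearMap_add hdet0 (-v) hmeas, ← mul_assoc,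
    ← ENNReal.ofReal_mul (by positivity), abs_inv, hdet, mul_inv_cancel₀ (by positivity),
    ENNReal.ofReal_one, one_mul]

variable [FiniteDimensional ℝ E] [MeasurableSpace E] [BorelSpace E]

/-- Surface integrals over the graph of a function that is differentiable over `s`. -/
theorem setLIntegral_graphMap_image (he : ‖e‖ = 1) (hLe : ∀ y, inner ℝ (L y) e = 0)
    {ψ : U → ℝ} (hψ : Continuous ψ) {s : Set U}
    (hs : MeasurableSet s) (hd : ∀ y ∈ s, DifferentiableAt ℝ ψ y) {g : E → ℝ≥0∞}
    (hg : Measurable g) :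
    ∫⁻ x in graphMap L e ψ '' s, g x ∂μHE[Module.finrank ℝ U] =
      ∫⁻ y in s, ENNReal.ofReal (√(1 + ‖gradient ψ y‖ ^ 2)) * g (graphMap L e ψ y) := by
  set f' : U → U →L[ℝ] E := fun y => L.toContinuousLinearMap + (fderiv ℝ ψ y).smulRight e with hf'
  have hf'app : ∀ y w, f' y w = L w + inner ℝ (gradient ψ y) w • e := by
    intro y w
    simp [hf', inner_gradient_left]
  have hJ : ∀ y, (f' y : U →ₗ[ℝ] E).normDet = √(1 + ‖gradient ψ y‖ ^ 2) := by
    intro y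
    have h := normDet_sq_of_inner_eq (f' y) (gradient ψ y) 1 1 fun w w' => by
      have hLe' : ∀ y, inner ℝ e (L y) = (0 : ℝ) := fun y => by rw [real_inner_comm, hLe]
      rw [hf'app, hf'app]
      simp only [inner_add_left, inner_add_right, real_inner_smul_left, real_inner_smul_right,
        L.inner_map_map, hLe, hLe', real_inner_self_eq_norm_sq, he]
      ring
    rw [one_pow, one_mul, one_mul] at h
    rw [← h, Real.sqrt_sq (LinearMap.normDet_nonneg _)]
  have hf'm : Measurable f' := by
    have h1 : Continuous fun A : U →L[ℝ] ℝ => L.toContinuousLinearMap + A.smulRight e :=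
      continuous_const.add ((ContinuousLinearMap.smulRightL ℝ U E).flip e).continuous
    exact h1.measurable.comp (measurable_fderiv ℝ ψ)
  have hfc : Continuous (graphMap L e ψ) := by
    have := L.continuous
    unfold graphMap; fun_prop
  rw [setLIntegral_image_eq_lintegral_normDet hs (f' := f') (fun y hy => ?_) hf'm (fun y _ => ?_)
    (injective_graphMap L he hLe ψ).injOn hfc.measurable hg]
  · simp_rw [hJ]
  · exact (L.toContinuousLinearMap.hasFDerivAt.add
      ((hd y hy).hasFDerivAt.smul_const e)).hasFDerivWithinAt
  · refine ((f' y : U →ₗ[ℝ] E).normDet_ne_zero_tfae.out 0 4).1 ?_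
    rw [hJ]; positivity

/-- Asymptotics of the potential of the surface measure of a Lipschitz flat graph: as the pole
`graphMap L e ψ a + t e` tends to the point over `a`, the integrals converge, after rescaling by
`t` around `a`, to the one over the tangent hyperplane. -/
theorem tendsto_lintegral_graphMap (he : ‖e‖ = 1) (hLe : ∀ y, inner ℝ (L y) e = 0)
    {ψ : U → ℝ} {K : ℝ≥0} (hψ : LipschitzWith K ψ) {a : U} {R : ℝ}
    (hR : 0 < R) (hd : ∀ y ∈ Metric.ball a R, DifferentiableAt ℝ ψ y)
    (hlim : ∀ᵐ ξ : U, Tendsto (fun t : ℝ => gradient ψ (a + t • ξ)) (𝓝[>] 0)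
      (𝓝 (gradient ψ a))) {n : ℕ} (hn : n = Module.finrank ℝ U + 1) :
    Tendsto (fun t : ℝ => ENNReal.ofReal t * ∫⁻ x in graphMap L e ψ '' Metric.ball a R,
        ENNReal.ofReal (‖x - (graphMap L e ψ a + t • e)‖⁻¹ ^ n) ∂μHE[Module.finrank ℝ U])
      (𝓝[>] 0) (𝓝 (ENNReal.ofReal (√(1 + ‖gradient ψ a‖ ^ 2)) *
        ∫⁻ y : U, ENNReal.ofReal (invHypot y ^ n))) := by
  set v := gradient ψ a with hv
  have hgm : Measurable (gradient ψ) := by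
    unfold gradient
    exact (InnerProductSpace.toDual ℝ U).symm.continuous.measurable.comp (measurable_fderiv ℝ ψ)
  -- the difference quotients of `ψ` at `a`
  set δ : ℝ → U → ℝ := fun t ξ => (ψ (a + t • ξ) - ψ a) / t with hδ
  set Φ : ℝ → U → ℝ := fun t ξ => √(1 + ‖gradient ψ (a + t • ξ)‖ ^ 2) *
    (√(‖ξ‖ ^ 2 + (δ t ξ - 1) ^ 2))⁻¹ ^ n with hΦ
  set F : ℝ → U → ℝ≥0∞ := fun t ξ =>
    (Metric.ball a R).indicator (fun _ => 1) (a + t • ξ) * ENNReal.ofReal (Φ t ξ) with hF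
  have hψc := hψ.continuous
  have hδm : ∀ t, Measurable (δ t) := fun t => by
    have : Continuous (δ t) := by simp only [hδ]; fun_prop
    exact this.measurable
  have hFm : ∀ t, Measurable (F t) := by
    intro t
    have h1 : Measurable fun ξ : U => a + t • ξ := by fun_prop
    have h2 : Measurable fun ξ : U => gradient ψ (a + t • ξ) := hgm.comp h1
    have h3 := hδm t
    have h4 : Measurable fun ξ : U =>
        (Metric.ball a R).indicator (fun _ => (1 : ℝ≥0∞)) (a + t • ξ) :=
      (measurable_const.indicator measurableSet_ball).comp h1
    exact h4.mul (ENNReal.measurable_ofReal.comp (by fun_prop))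
  -- the integrals in the rescaled variable
  have hrescale : ∀ t : ℝ, 0 < t → ENNReal.ofReal t * ∫⁻ x in graphMap L e ψ '' Metric.ball a R,
      ENNReal.ofReal (‖x - (graphMap L e ψ a + t • e)‖⁻¹ ^ n) ∂μHE[Module.finrank ℝ U] =
      ∫⁻ ξ, F t ξ := by
    intro t ht
    rw [setLIntegral_graphMap_image L he hLe hψc measurableSet_ball hd (by fun_prop)]
    set G : U → ℝ≥0∞ := fun y => ENNReal.ofReal (√(1 + ‖gradient ψ y‖ ^ 2)) *
      ENNReal.ofReal (‖graphMap L e ψ y - (graphMap L e ψ a + t • e)‖⁻¹ ^ n) with hG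
    have hGm : Measurable G := by
      have : Measurable (graphMap L e ψ) := by
        have := L.continuous
        have : Continuous (graphMap L e ψ) := by unfold graphMap; fun_prop
        exact this.measurable
      have h1 : Measurable fun y => √(1 + ‖gradient ψ y‖ ^ 2) := by fun_prop
      fun_prop
    have hdet : (t • (LinearMap.id : U →ₗ[ℝ] U)).det = t ^ Module.finrank ℝ U := by
      rw [LinearMap.det_smul, LinearMap.det_id, mul_one]
    have hcv := lintegral_comp_linearMap_add (M := t • (LinearMap.id : U →ₗ[ℝ] U))
      (by rw [hdet]; positivity) a (hGm.indicator (measurableSet_ball (x := a) (ε := R)))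
    rw [hdet, abs_of_pos (by positivity)] at hcv
    have hFG : ∀ ξ, F t ξ = ENNReal.ofReal (t ^ n) * (Metric.ball a R).indicator G
        ((t • (LinearMap.id : U →ₗ[ℝ] U)) ξ + a) := by
      intro ξ
      have harg : (t • (LinearMap.id : U →ₗ[ℝ] U)) ξ + a = a + t • ξ := by simp [add_comm]
      rw [harg]
      by_cases hmem : a + t • ξ ∈ Metric.ball a R
      · rw [hF]
        simp only [indicator_of_mem hmem, one_mul, hG]
        have hdiff : graphMap L e ψ (a + t • ξ) - (graphMap L e ψ a + t • e) =
            t • (L ξ + (δ t ξ - 1) • e) := by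
          have : ψ (a + t • ξ) - ψ a = t * δ t ξ := by simp only [hδ]; field_simp
          have h2 : ψ (a + t • ξ) = ψ a + t * δ t ξ := by linarith
          simp only [graphMap, map_add, map_smul, h2]
          module
        rw [hdiff, norm_smul, Real.norm_of_nonneg ht.le, norm_map_add_smul L he hLe,
          ← ENNReal.ofReal_mul (by positivity), ← ENNReal.ofReal_mul (by positivity)]
        congr 1
        rw [mul_inv, mul_pow, inv_pow t]
        simp only [hΦ]
        field_simp
      · rw [hF]
        simp only [indicator_of_notMem hmem, zero_mul, mul_zero]
    simp_rw [hFG]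
    rw [lintegral_const_mul' _ _ ENNReal.ofReal_ne_top, hcv, ← mul_assoc,
      ← ENNReal.ofReal_mul (by positivity), lintegral_indicator measurableSet_ball,
      show t ^ n * (t ^ Module.finrank ℝ U)⁻¹ = t by rw [hn, pow_succ]; field_simp]
  have hlimint : ENNReal.ofReal (√(1 + ‖v‖ ^ 2)) * ∫⁻ y : U, ENNReal.ofReal (invHypot y ^ n) =
      ∫⁻ ξ : U, ENNReal.ofReal (√(1 + ‖v‖ ^ 2) *
        (√(‖ξ‖ ^ 2 + (inner ℝ v ξ - 1) ^ 2))⁻¹ ^ n) := by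
    simp_rw [ENNReal.ofReal_mul (Real.sqrt_nonneg _)]
    rw [lintegral_const_mul' _ _ ENNReal.ofReal_ne_top, lintegral_inv_norm_tilted v hn]
  rw [hlimint]
  refine Tendsto.congr' (f₁ := fun t => ∫⁻ ξ, F t ξ) ?_ ?_
  · filter_upwards [self_mem_nhdsWithin] with t ht using (hrescale t ht).symm
  set C : ℝ := 2 + K with hC
  have hnr : (Module.finrank ℝ U : ℝ) < n := by rw [hn]; push_cast; linarith
  refine tendsto_lintegral_filter_of_dominated_convergence
    (fun ξ => ENNReal.ofReal (√(1 + K ^ 2) * C ^ n) * ENNReal.ofReal ((1 + ‖ξ‖) ^ (-(n : ℝ))))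
    (Eventually.of_forall hFm) ?_ ?_ ?_
  · filter_upwards [self_mem_nhdsWithin] with t (ht : 0 < t)
    refine Eventually.of_forall fun ξ => ?_
    rw [← ENNReal.ofReal_mul (by positivity)]
    by_cases hmem : a + t • ξ ∈ Metric.ball a R
    · simp only [hF, indicator_of_mem hmem, one_mul]
      refine ENNReal.ofReal_le_ofReal ?_
      have h1 : √(1 + ‖gradient ψ (a + t • ξ)‖ ^ 2) ≤ √(1 + K ^ 2) := by
        refine Real.sqrt_le_sqrt ?_
        have : ‖gradient ψ (a + t • ξ)‖ ≤ K := by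
          rw [gradient, LinearIsometryEquiv.norm_map]
          exact norm_fderiv_le_of_lipschitz ℝ hψ
        gcongr
      -- the Lipschitz bound keeps the graph away from the pole
      have h2 : |δ t ξ| ≤ K * ‖ξ‖ := by
        have := hψ.dist_le_mul (a + t • ξ) a
        rw [dist_eq_norm, dist_eq_norm, add_sub_cancel_left, norm_smul, Real.norm_eq_abs,
          Real.norm_of_nonneg ht.le] at this
        simp only [hδ]
        rw [abs_div, abs_of_pos ht, div_le_iff₀ ht]
        linarith
      set D := √(‖ξ‖ ^ 2 + (δ t ξ - 1) ^ 2) with hD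
      have h3 : ‖ξ‖ ≤ D := Real.le_sqrt_of_sq_le (by nlinarith [sq_nonneg (δ t ξ - 1)])
      have h4 : |δ t ξ - 1| ≤ D := Real.abs_le_sqrt (by nlinarith [sq_nonneg ‖ξ‖])
      have h5 : 1 + ‖ξ‖ ≤ C * D := by
        have h6 : 1 ≤ |δ t ξ - 1| + |δ t ξ| := by
          have := abs_sub (δ t ξ) (δ t ξ - 1)
          rw [sub_sub_cancel, abs_one] at this
          linarith
        have h7 : (K : ℝ) * ‖ξ‖ ≤ K * D := by gcongr
        rw [hC]; linarith
      have hD0 : 0 < D := by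
        have : 0 < C * D := lt_of_lt_of_le (by positivity) h5
        exact pos_of_mul_pos_right this (by positivity)
      have h8 : D⁻¹ ≤ C * (1 + ‖ξ‖)⁻¹ := by
        rw [← div_eq_mul_inv, le_div_iff₀ (by positivity), inv_mul_le_iff₀ hD0]
        linarith
      have h9 : (1 + ‖ξ‖) ^ (-(n : ℝ)) = (1 + ‖ξ‖)⁻¹ ^ n := by
        rw [Real.rpow_neg (by positivity), Real.rpow_natCast, inv_pow]
      calc Φ t ξ ≤ √(1 + K ^ 2) * (C * (1 + ‖ξ‖)⁻¹) ^ n := by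
            simp only [hΦ]
            gcongr
        _ = _ := by rw [h9, mul_pow]; ring
    · simp only [hF, indicator_of_notMem hmem, zero_mul, zero_le]
  · rw [lintegral_const_mul' _ _ ENNReal.ofReal_ne_top]
    exact ENNReal.mul_ne_top ENNReal.ofReal_ne_top (finite_integral_one_add_norm hnr).ne
  · filter_upwards [hlim] with ξ hξ
    have hline : Tendsto (fun t : ℝ => a + t • ξ) (𝓝[>] 0) (𝓝 a) := by
      have : Continuous fun t : ℝ => a + t • ξ := by fun_prop
      have := this.tendsto 0
      rw [zero_smul, add_zero] at this
      exact this.mono_left nhdsWithin_le_nhds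
    have hball : ∀ᶠ t in 𝓝[>] (0 : ℝ), a + t • ξ ∈ Metric.ball a R :=
      hline.eventually (Metric.ball_mem_nhds a hR)
    have hδlim : Tendsto (fun t => δ t ξ) (𝓝[>] 0) (𝓝 (inner ℝ v ξ)) := by
      have h1 := (hd a (Metric.mem_ball_self hR)).hasFDerivAt.hasLineDerivAt ξ
      have h2 := h1.tendsto_slope_zero_right
      rw [hv, inner_gradient_left]
      refine h2.congr fun t => ?_
      simp only [hδ, smul_eq_mul]
      ring
    have hQ : √(‖ξ‖ ^ 2 + (inner ℝ v ξ - 1) ^ 2) ≠ 0 := by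
      refine (Real.sqrt_pos.2 ?_).ne'
      rcases eq_or_ne ξ 0 with rfl | h0
      · simp
      · have := norm_pos_iff.2 h0
        positivity
    have hΦlim : Tendsto (fun t => Φ t ξ) (𝓝[>] 0) (𝓝 (√(1 + ‖v‖ ^ 2) *
        (√(‖ξ‖ ^ 2 + (inner ℝ v ξ - 1) ^ 2))⁻¹ ^ n)) := by
      have h1 : Tendsto (fun t : ℝ => √(1 + ‖gradient ψ (a + t • ξ)‖ ^ 2)) (𝓝[>] 0)
          (𝓝 (√(1 + ‖v‖ ^ 2))) := ((hξ.norm.pow 2).const_add 1).sqrt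
      have h2 : Tendsto (fun t => √(‖ξ‖ ^ 2 + (δ t ξ - 1) ^ 2)) (𝓝[>] 0)
          (𝓝 (√(‖ξ‖ ^ 2 + (inner ℝ v ξ - 1) ^ 2))) :=
        (((hδlim.sub_const 1).pow 2).const_add (‖ξ‖ ^ 2)).sqrt
      exact h1.mul ((h2.inv₀ hQ).pow n)
    refine (ENNReal.tendsto_ofReal hΦlim).congr' ?_
    filter_upwards [hball] with t ht
    simp only [hF, indicator_of_mem ht, one_mul]

end Graph

/-! ### Touching points and graph coordinates -/

section Touching

variable {U E : Type*} [NormedAddCommGroup U] [InnerProductSpace ℝ U] [CompleteSpace U]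
  [NormedAddCommGroup E] [InnerProductSpace ℝ E]

/-- At a point nearest to `L h₀ + s₀ e`, a graph is tangent to the sphere around that center; this
determines the height of the point above the center from the slope of the graph. -/
theorem sq_height_mul_of_isLocalMin (L : U →ₗᵢ[ℝ] E) {e : E} (he : ‖e‖ = 1)
    (hLe : ∀ y, inner ℝ (L y) e = 0) {ψ : U → ℝ} {a h₀ : U} {s₀ : ℝ}
    (hd : DifferentiableAt ℝ ψ a)
    (hmin : IsLocalMin (fun y => ‖graphMap L e ψ y - (L h₀ + s₀ • e)‖) a) :
    (ψ a - s₀) ^ 2 * (1 + ‖gradient ψ a‖ ^ 2) = ‖graphMap L e ψ a - (L h₀ + s₀ • e)‖ ^ 2 := by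
  have hnorm : ∀ y, ‖graphMap L e ψ y - (L h₀ + s₀ • e)‖ ^ 2 =
      ‖y - h₀‖ ^ 2 + (ψ y - s₀) ^ 2 := by
    intro y
    have : graphMap L e ψ y - (L h₀ + s₀ • e) = L (y - h₀) + (ψ y - s₀) • e := by
      rw [graphMap, map_sub]; module
    rw [this, norm_map_add_smul L he hLe, Real.sq_sqrt (by positivity)]
  have hmin' : IsLocalMin (fun y => ‖y - h₀‖ ^ 2 + (ψ y - s₀) ^ 2) a := by
    filter_upwards [hmin] with y hy
    rw [← hnorm, ← hnorm]
    exact pow_le_pow_left₀ (norm_nonneg _) hy 2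
  have hder := (hasFDerivAt_norm_sub_sq h₀ a).add ((hd.hasFDerivAt.sub_const s₀).pow 2)
  have h0 := hmin'.hasFDerivAt_eq_zero hder
  have hh : a - h₀ = -(ψ a - s₀) • gradient ψ a := by
    refine ext_inner_right ℝ fun w => ?_
    have := congrArg (fun A : U →L[ℝ] ℝ => A w) h0
    simp only [_root_.add_apply, _root_.smul_apply, smul_eq_mul, innerSL_apply_apply,
      _root_.zero_apply, ← inner_gradient_left] at this
    rw [real_inner_smul_left, inner_gradient_left]
    norm_num at this
    linarith
  rw [hnorm, hh, norm_smul, mul_pow, Real.norm_eq_abs, sq_abs]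
  ring

end Touching

section Coordinates

variable {d : ℕ}

/-- The isometric embedding of `ℝᵈ` as the horizontal hyperplane `x_n = 0` of `ℝᵈ⁺¹`. -/
noncomputable def horizontalEmbedding (d : ℕ) :
    EuclideanSpace ℝ (Fin d) →ₗᵢ[ℝ] EuclideanSpace ℝ (Fin (d + 1)) where
  toFun y := WithLp.toLp 2 (Fin.snoc (α := fun _ => ℝ) y 0)
  map_add' y y' := by
    ext i
    refine Fin.lastCases ?_ (fun j => ?_) i <;> simp
  map_smul' c y := by
    ext i
    refine Fin.lastCases ?_ (fun j => ?_) i <;> simp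
  norm_map' y := by
    simp [EuclideanSpace.norm_eq, Fin.sum_univ_castSucc]

/-- The upward vertical unit vector of `ℝᵈ⁺¹`. -/
noncomputable def verticalUnit (d : ℕ) : EuclideanSpace ℝ (Fin (d + 1)) :=
  EuclideanSpace.single (Fin.last d) 1

theorem norm_verticalUnit : ‖verticalUnit d‖ = 1 := by simp [verticalUnit]

theorem horizontalEmbedding_castSucc (y : EuclideanSpace ℝ (Fin d)) (j : Fin d) :
    horizontalEmbedding d y j.castSucc = y j := by
  simp [horizontalEmbedding]

theorem horizontalEmbedding_last (y : EuclideanSpace ℝ (Fin d)) :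
    horizontalEmbedding d y (Fin.last d) = 0 := by
  simp [horizontalEmbedding]

theorem inner_horizontalEmbedding_verticalUnit (y : EuclideanSpace ℝ (Fin d)) :
    inner ℝ (horizontalEmbedding d y) (verticalUnit d) = 0 := by
  simp [verticalUnit, EuclideanSpace.inner_single_right, horizontalEmbedding_last]

theorem horizontalPart_add_smul (y : EuclideanSpace ℝ (Fin d)) (t : ℝ) :
    horizontalPart (horizontalEmbedding d y + t • verticalUnit d) = y := by
  ext j
  simp [horizontalPart, horizontalEmbedding_castSucc, verticalUnit]

theorem lastCoord_add_smul (y : EuclideanSpace ℝ (Fin d)) (t : ℝ) :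
    lastCoord (horizontalEmbedding d y + t • verticalUnit d) = t := by
  simp [lastCoord, horizontalEmbedding_last, verticalUnit]

theorem horizontalEmbedding_add_smul (x : EuclideanSpace ℝ (Fin (d + 1))) :
    horizontalEmbedding d (horizontalPart x) + lastCoord x • verticalUnit d = x := by
  ext i
  refine Fin.lastCases ?_ (fun j => ?_) i
  · simp [lastCoord, horizontalEmbedding_last, verticalUnit]
  · simp [horizontalEmbedding_castSucc, horizontalPart, verticalUnit]

theorem continuous_horizontalPart : Continuous (horizontalPart (d := d)) := by
  unfold horizontalPart
  fun_prop

theorem continuous_lastCoord : Continuous (lastCoord (d := d)) := by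
  unfold lastCoord
  fun_prop

theorem isOpen_rectNhd (z : EuclideanSpace ℝ (Fin (d + 1))) (R a b : ℝ) :
    IsOpen (rectNhd z R a b) :=
  (Metric.isOpen_ball.preimage continuous_horizontalPart).inter
    (isOpen_Ioo.preimage continuous_lastCoord)

end Coordinates

/-! ### The mean value property and the boundary area -/

section Main

variable {d : ℕ} {Ω : Set (EuclideanSpace ℝ (Fin (d + 1)))}
  {x₀ z : EuclideanSpace ℝ (Fin (d + 1))}

theorem rpow_neg_half_eq {x : ℝ} (hx : 0 ≤ x) (n : ℕ) :
    (x ^ 2) ^ (-(n : ℝ) / 2) = x⁻¹ ^ n := by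
  rw [neg_div, Real.rpow_neg (by positivity), ← Real.rpow_natCast x 2, ← Real.rpow_mul hx,
    show ((2 : ℕ) : ℝ) * ((n : ℝ) / 2) = n by push_cast; ring, Real.rpow_natCast, inv_pow]

/-- The mean value property for the Poisson kernel with pole `ζ` outside `closure Ω`, when the
ball of radius `r` is inscribed in `Ω`. -/
theorem IsHarmonicPseudosphere.kernel_bound (hΩ : IsHarmonicPseudosphere Ω x₀) {r c : ℝ}
    (hr : ∀ x ∈ frontier Ω, r ≤ ‖x - x₀‖) (hr0 : 0 ≤ r) {ζ : EuclideanSpace ℝ (Fin (d + 1))}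
    (hζ : ζ ∉ closure Ω) (hc : 0 ≤ c) (hζc : ‖ζ - x₀‖ ^ 2 ≤ r ^ 2 + c) :
    ENNReal.ofReal (‖ζ - x₀‖ ^ 2 * ‖ζ - x₀‖⁻¹ ^ (d + 1)) * μHE[d] (frontier Ω) ≤
      ENNReal.ofReal c *
        ∫⁻ x in frontier Ω, ENNReal.ofReal (‖x - ζ‖⁻¹ ^ (d + 1)) ∂μHE[d] := by
  have hfin := hΩ.measure_lt_top
  have hharm := harmonicContOnCl_poissonKernelAt (x₀ := x₀) hζ
  have hmean := hΩ.mean_value _ hharm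
  have hK : ∀ x, poissonKernelAt x₀ ζ x =
      (‖ζ - x₀‖ ^ 2 - ‖x - x₀‖ ^ 2) * ‖x - ζ‖⁻¹ ^ (d + 1) := by
    intro x
    rw [poissonKernelAt, finrank_euclideanSpace_fin, rpow_neg_half_eq (norm_nonneg _)]
  have hcpt : IsCompact (frontier Ω) :=
    Metric.isCompact_of_isClosed_isBounded isClosed_frontier
      (hΩ.isBounded.closure.subset frontier_subset_closure)
  have hint : ∀ f : EuclideanSpace ℝ (Fin (d + 1)) → ℝ, ContinuousOn f (frontier Ω) →
      IntegrableOn f (frontier Ω) μHE[d] := by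
    intro f hf
    obtain ⟨C, hC⟩ := hcpt.exists_bound_of_continuousOn hf
    exact IntegrableOn.of_bound hfin
      (hf.aestronglyMeasurable isClosed_frontier.measurableSet) C
      ((ae_restrict_iff' isClosed_frontier.measurableSet).2 (Eventually.of_forall hC))
  have hne : ∀ x ∈ frontier Ω, ‖x - ζ‖ ≠ 0 := by
    intro x hx h0
    exact hζ (sub_eq_zero.1 (norm_eq_zero.1 h0) ▸ frontier_subset_closure hx)
  have hgc : ContinuousOn (fun x => c * ‖x - ζ‖⁻¹ ^ (d + 1)) (frontier Ω) :=
    continuousOn_const.mul ((ContinuousOn.inv₀ (by fun_prop) hne).pow _)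
  have hle : ∫ x in frontier Ω, poissonKernelAt x₀ ζ x ∂μHE[d] ≤
      ∫ x in frontier Ω, c * ‖x - ζ‖⁻¹ ^ (d + 1) ∂μHE[d] := by
    refine setIntegral_mono_on (hint _ (hharm.continuousOn.mono frontier_subset_closure))
      (hint _ hgc) isClosed_frontier.measurableSet fun x hx => ?_
    rw [hK]
    gcongr
    have := pow_le_pow_left₀ hr0 (hr x hx) 2
    linarith
  rw [← measure_smul_setAverage _ hfin.ne, ← hmean, hK, sub_self, norm_zero, smul_eq_mul,
    norm_sub_rev x₀ ζ] at hle
  have h1 := ENNReal.ofReal_le_ofReal hle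
  rw [ofReal_integral_eq_lintegral_ofReal (hint _ hgc)
    (Eventually.of_forall fun x => by positivity), ENNReal.ofReal_mul measureReal_nonneg,
    ofReal_measureReal hfin.ne] at h1
  simp_rw [ENNReal.ofReal_mul hc] at h1
  rw [lintegral_const_mul' _ _ ENNReal.ofReal_ne_top] at h1
  rw [mul_comm]
  simpa using h1

/-- At a Lipschitz flat touching point the surface density of harmonic measure is at least that of
the inscribed ball; hence the boundary is not larger than the sphere. -/
theorem IsHarmonicPseudosphere.frontier_le (hΩ : IsHarmonicPseudosphere Ω x₀)
    (hz : z ∈ touchingSet Ω x₀) (hflat : IsLipschitzFlatAt Ω z) (hr0 : 0 < ‖z - x₀‖) :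
    μHE[d] (frontier Ω) ≤ 2 * (ENNReal.ofReal (‖z - x₀‖ ^ d) * halfSphereArea d) := by
  obtain ⟨R, α, β, ψ₀, hR, hαz, hzβ, hψ₀, ⟨K, hK⟩, hdiff, hgrad, hfr, hin⟩ := hflat
  obtain ⟨ψ, hψ, hψeq⟩ := hK.extend_real
  set r := ‖z - x₀‖ with hr
  set L := horizontalEmbedding d
  set e := verticalUnit d
  have he : ‖e‖ = 1 := norm_verticalUnit
  have hLe : ∀ y, inner ℝ (L y) e = 0 := inner_horizontalEmbedding_verticalUnit
  set a := horizontalPart z with ha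
  have hout : ∀ x ∈ frontier Ω, r ≤ ‖x - x₀‖ := by
    intro x hx
    rw [hr, ← dist_eq_norm, ← dist_eq_norm, dist_comm z, dist_comm x, hz.2]
    exact Metric.infDist_le_dist_of_mem hx
  -- transfer to the Lipschitz extension `ψ` of `ψ₀`
  have hev : ∀ y ∈ Metric.ball a R, ψ₀ =ᶠ[𝓝 y] ψ := fun y hy =>
    hψeq.eventuallyEq_of_mem (Metric.isOpen_ball.mem_nhds hy)
  have hd : ∀ y ∈ Metric.ball a R, DifferentiableAt ℝ ψ y := fun y hy =>
    (hev y hy).differentiableAt_iff.1 (hdiff y hy)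
  have hg : ∀ y ∈ Metric.ball a R, gradient ψ₀ y = gradient ψ y := fun y hy =>
    (hev y hy).gradient_eq
  have haR : a ∈ Metric.ball a R := Metric.mem_ball_self hR
  have hlim : ∀ᵐ ξ : EuclideanSpace ℝ (Fin d),
      Tendsto (fun t : ℝ => gradient ψ (a + t • ξ)) (𝓝[>] 0) (𝓝 (gradient ψ a)) := by
    filter_upwards [hgrad] with ξ hξ
    rw [← hg a haR]
    refine (hξ.mono_left (nhdsWithin_mono _ fun t (ht : 0 < t) => ht.ne')).congr' ?_
    have hline : Tendsto (fun t : ℝ => a + t • ξ) (𝓝[>] 0) (𝓝 a) := by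
      have : Continuous fun t : ℝ => a + t • ξ := by fun_prop
      have := this.tendsto 0
      rw [zero_smul, add_zero] at this
      exact this.mono_left nhdsWithin_le_nhds
    filter_upwards [hline.eventually (Metric.ball_mem_nhds a hR)] with t ht using hg _ ht
  have hzrect : z ∈ rectNhd z R α β := ⟨haR, hαz, hzβ⟩
  have hza : lastCoord z = ψ a := by
    have : z ∈ frontier Ω ∩ rectNhd z R α β := ⟨hz.1, hzrect⟩
    rw [hfr] at this
    rw [this.2, hψeq haR]
  have hGa : graphMap L e ψ a = z := by
    rw [graphMap, ← hza]; exact horizontalEmbedding_add_smul z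
  have hgraph : frontier Ω ∩ rectNhd z R α β = graphMap L e ψ '' Metric.ball a R := by
    rw [hfr]
    ext x
    constructor
    · rintro ⟨h1, h2⟩
      refine ⟨horizontalPart x, h1, ?_⟩
      rw [graphMap, ← hψeq h1, ← h2]
      exact horizontalEmbedding_add_smul x
    · rintro ⟨y, hy, rfl⟩
      refine ⟨?_, ?_⟩
      · rw [graphMap, horizontalPart_add_smul]; exact hy
      · rw [graphMap, lastCoord_add_smul, horizontalPart_add_smul, hψeq hy]
  -- tangency of the graph to the inscribed sphere
  set S := √(1 + ‖gradient ψ a‖ ^ 2) with hS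
  have hS0 : 0 < S := Real.sqrt_pos.2 (by positivity)
  set τ := ψ a - lastCoord x₀ with hτ
  have hx₀ := horizontalEmbedding_add_smul x₀
  have htau : τ ≤ r / S := by
    have h1 := sq_height_mul_of_isLocalMin L he hLe (h₀ := horizontalPart x₀)
      (s₀ := lastCoord x₀) (hd a haR) (by
        filter_upwards [Metric.ball_mem_nhds a hR] with y hy
        rw [hx₀, hGa]
        refine hout _ ?_
        have : graphMap L e ψ y ∈ frontier Ω ∩ rectNhd z R α β := by
          rw [hgraph]; exact mem_image_of_mem _ hy
        exact this.1)
    rw [hx₀, hGa] at h1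
    have h2 : (τ * S) ^ 2 = r ^ 2 := by
      rw [mul_pow, hS, Real.sq_sqrt (by positivity)]; exact h1
    rw [le_div_iff₀ hS0]
    exact (le_abs_self _).trans (abs_le_of_sq_le_sq h2.le hr0.le)
  have hdist : ∀ t : ℝ, ‖z + t • e - x₀‖ ^ 2 = r ^ 2 + t * (2 * τ + t) := by
    intro t
    have hinner : inner ℝ (z - x₀) e = τ := by
      rw [← hGa, graphMap, ← hx₀]
      simp only [inner_sub_left, inner_add_left, real_inner_smul_left,
        real_inner_self_eq_norm_sq, he]
      change inner ℝ (L a) e + _ - (inner ℝ (L _) e + lastCoord x₀ * inner ℝ e e) = τ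
      rw [hLe, hLe, real_inner_self_eq_norm_sq, he, hτ]
      ring
    rw [add_sub_right_comm, norm_add_sq_real, real_inner_smul_right, hinner, norm_smul, he,
      Real.norm_eq_abs, mul_one, sq_abs]
    ring
  -- poles just above `z` lie outside `closure Ω`
  have hpole : ∀ᶠ t in 𝓝[>] (0 : ℝ), z + t • e ∉ closure Ω := by
    have hc : Tendsto (fun t : ℝ => z + t • e) (𝓝[>] 0) (𝓝 z) := by
      have : Continuous fun t : ℝ => z + t • e := by fun_prop
      have := this.tendsto 0
      rw [zero_smul, add_zero] at this
      exact this.mono_left nhdsWithin_le_nhds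
    filter_upwards [hc.eventually ((isOpen_rectNhd z R α β).mem_nhds hzrect), self_mem_nhdsWithin]
      with t ht (ht0 : 0 < t) hcl
    have hzt : z + t • e = L a + (ψ a + t) • e := by
      rw [← hGa, graphMap]; module
    have h1 : horizontalPart (z + t • e) = a := by
      rw [hzt]; exact horizontalPart_add_smul _ _
    have h2 : lastCoord (z + t • e) = ψ a + t := by
      rw [hzt]; exact lastCoord_add_smul _ _
    rw [closure_eq_self_union_frontier] at hcl
    rcases hcl with hcl | hcl
    · have : z + t • e ∈ Ω ∩ rectNhd z R α β := ⟨hcl, ht⟩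
      rw [hin] at this
      have h3 := this.2.2.1
      rw [h1, h2, hψeq haR] at h3
      linarith
    · have : z + t • e ∈ frontier Ω ∩ rectNhd z R α β := ⟨hcl, ht⟩
      rw [hfr] at this
      have h3 := this.2
      rw [h1, h2, hψeq haR] at h3
      linarith
  obtain ⟨ε, hε, hεball⟩ := Metric.isOpen_iff.1 (isOpen_rectNhd z R α β) z hzrect
  set I : ℝ → ℝ≥0∞ := fun t => ∫⁻ x in graphMap L e ψ '' Metric.ball a R,
    ENNReal.ofReal (‖x - (graphMap L e ψ a + t • e)‖⁻¹ ^ (d + 1)) ∂μHE[d] with hI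
  set M : ℝ≥0∞ := ENNReal.ofReal ((ε / 2)⁻¹ ^ (d + 1)) * μHE[d] (frontier Ω) with hM
  have hMtop : M ≠ ∞ := ENNReal.mul_ne_top ENNReal.ofReal_ne_top hΩ.measure_lt_top.ne
  -- the part of the boundary away from `z` contributes a bounded amount
  have hsplit : ∀ t : ℝ, 0 < t → t < ε / 2 → ∫⁻ x in frontier Ω,
      ENNReal.ofReal (‖x - (z + t • e)‖⁻¹ ^ (d + 1)) ∂μHE[d] ≤ I t + M := by
    intro t ht htε
    have hcov : frontier Ω ⊆ (graphMap L e ψ '' Metric.ball a R) ∪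
        (frontier Ω \ rectNhd z R α β) := by
      rw [← hgraph, inter_union_sdiff]
    refine (lintegral_mono_set hcov).trans ((lintegral_union_le _ _ _).trans ?_)
    gcongr
    · rw [hI]; simp only [hGa]; exact le_rfl
    · have hmeas : MeasurableSet (frontier Ω \ rectNhd z R α β) :=
        (isClosed_frontier (s := Ω)).measurableSet.diff (isOpen_rectNhd z R α β).measurableSet
      calc _ ≤ ∫⁻ _ in frontier Ω \ rectNhd z R α β,
            ENNReal.ofReal ((ε / 2)⁻¹ ^ (d + 1)) ∂μHE[d] := by
            refine setLIntegral_mono' hmeas fun x hx => ENNReal.ofReal_le_ofReal ?_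
            have h1 : ε ≤ ‖x - z‖ := by
              by_contra! h
              exact hx.2 (hεball (mem_ball_iff_norm.2 h))
            have h2 : ε / 2 ≤ ‖x - (z + t • e)‖ := by
              have := norm_sub_norm_le (x - z) (t • e)
              rw [norm_smul, he, Real.norm_of_nonneg ht.le, sub_sub] at this
              linarith
            gcongr
        _ ≤ M := by
            rw [setLIntegral_const, hM]
            gcongr
            exact sdiff_subset
  have hbound : ∀ᶠ t in 𝓝[>] (0 : ℝ),
      ENNReal.ofReal (‖z + t • e - x₀‖ ^ 2 * ‖z + t • e - x₀‖⁻¹ ^ (d + 1)) * μHE[d] (frontier Ω) ≤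
      ENNReal.ofReal (2 * (r / S) + t) * (ENNReal.ofReal t * I t + ENNReal.ofReal t * M) := by
    filter_upwards [hpole, self_mem_nhdsWithin,
      nhdsWithin_le_nhds (Iio_mem_nhds (half_pos hε))] with t ht (ht0 : 0 < t) (htε : t < ε / 2)
    have hrS : 0 ≤ r / S := by positivity
    refine (hΩ.kernel_bound hout hr0.le ht (c := (2 * (r / S) + t) * t) (by positivity) ?_).trans ?_
    · rw [hdist, mul_comm t]
      gcongr
    · rw [ENNReal.ofReal_mul (by positivity), mul_assoc, ← mul_add]
      gcongr
      exact hsplit t ht0 htε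
  have hlim1 : Tendsto (fun t : ℝ =>
      ENNReal.ofReal (‖z + t • e - x₀‖ ^ 2 * ‖z + t • e - x₀‖⁻¹ ^ (d + 1)) * μHE[d] (frontier Ω))
      (𝓝[>] 0) (𝓝 (ENNReal.ofReal (r ^ 2 * r⁻¹ ^ (d + 1)) * μHE[d] (frontier Ω))) := by
    refine ENNReal.Tendsto.mul_const (ENNReal.tendsto_ofReal ?_) (Or.inr hΩ.measure_lt_top.ne)
    have h1 : Tendsto (fun t : ℝ => ‖z + t • e - x₀‖) (𝓝[>] 0) (𝓝 r) := by
      have : Continuous fun t : ℝ => ‖z + t • e - x₀‖ := by fun_prop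
      have := this.tendsto 0
      rw [zero_smul, add_zero] at this
      exact this.mono_left nhdsWithin_le_nhds
    exact (h1.pow 2).mul ((h1.inv₀ hr0.ne').pow _)
  have hlim2 : Tendsto (fun t : ℝ => ENNReal.ofReal (2 * (r / S) + t) *
      (ENNReal.ofReal t * I t + ENNReal.ofReal t * M)) (𝓝[>] 0)
      (𝓝 (ENNReal.ofReal (2 * (r / S) + 0) *
        (ENNReal.ofReal S * halfSphereArea d + ENNReal.ofReal 0 * M))) := by
    have hid : Tendsto (fun t : ℝ => t) (𝓝[>] 0) (𝓝 0) := nhdsWithin_le_nhds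
    have h1 := tendsto_lintegral_graphMap L he hLe hψ hR hd hlim (n := d + 1)
      (by rw [finrank_euclideanSpace_fin])
    rw [finrank_euclideanSpace_fin] at h1
    have h2 : Tendsto (fun t : ℝ => ENNReal.ofReal t * M) (𝓝[>] 0) (𝓝 (ENNReal.ofReal 0 * M)) :=
      ENNReal.Tendsto.mul_const (ENNReal.tendsto_ofReal hid) (Or.inr hMtop)
    refine ENNReal.Tendsto.mul (ENNReal.tendsto_ofReal (hid.const_add _)) (Or.inl ?_) (h1.add h2)
      (Or.inr ENNReal.ofReal_ne_top)
    rw [ne_eq, ENNReal.ofReal_eq_zero, not_le]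
    positivity
  have hfinal := le_of_tendsto_of_tendsto hlim1 hlim2 hbound
  rw [ENNReal.ofReal_zero, zero_mul, add_zero, add_zero, ← mul_assoc,
    ← ENNReal.ofReal_mul (by positivity),
    show 2 * (r / S) * S = 2 * r by field_simp] at hfinal
  have hmul := mul_le_mul_right hfinal (ENNReal.ofReal (r ^ d * r⁻¹))
  rw [← mul_assoc, ← mul_assoc, ← ENNReal.ofReal_mul (by positivity),
    ← ENNReal.ofReal_mul (by positivity),
    show r ^ d * r⁻¹ * (r ^ 2 * r⁻¹ ^ (d + 1)) = 1 by rw [pow_succ r⁻¹, inv_pow]; field_simp,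
    show r ^ d * r⁻¹ * (2 * r) = 2 * r ^ d by field_simp, ENNReal.ofReal_one, one_mul,
    ENNReal.ofReal_mul zero_le_two, ENNReal.ofReal_ofNat, mul_assoc] at hmul
  exact hmul

end Main

theorem corollary1p5 (d : ℕ) (hd : 2 ≤ d + 1)
    (Ω : Set (EuclideanSpace ℝ (Fin (d + 1)))) (x₀ z : EuclideanSpace ℝ (Fin (d + 1)))
    (hΩ : IsHarmonicPseudosphere Ω x₀) (hz : z ∈ touchingSet Ω x₀)
    (hflat : IsLipschitzFlatAt Ω z) :
    frontier Ω = Metric.sphere x₀ (dist x₀ z) := by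
  have hrz : dist x₀ z = ‖z - x₀‖ := by rw [dist_comm, dist_eq_norm]
  have hdisj : ∀ x ∈ frontier Ω, x ∉ Ω := fun x hx => by
    rw [hΩ.isOpen.frontier_eq] at hx; exact hx.2
  have hr : 0 < dist x₀ z := by
    rw [dist_pos]
    rintro rfl
    exact hdisj _ hz.1 hΩ.center_mem
  have hball : Metric.ball x₀ (dist x₀ z) ⊆ Ω := by
    intro x hx
    by_contra hxΩ
    obtain ⟨y, hy, hyf⟩ :=
      (Metric.isPreconnected_ball (x := x₀) (r := dist x₀ z)).exists_mem_frontier hΩ.isOpen ⟨x₀, Metric.mem_ball_self hr, hΩ.center_mem⟩ ⟨x, hx, hxΩ⟩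
    have h1 := Metric.infDist_le_dist_of_mem (x := x₀) hyf
    rw [← hz.2, dist_comm x₀ y] at h1
    exact absurd (Metric.mem_ball.1 hy) (not_lt.2 h1)
  have hle := hΩ.frontier_le hz hflat (hrz ▸ hr)
  rw [← hrz] at hle
  have hsub : Ω ⊆ Metric.closedBall x₀ (dist x₀ z) := by
    intro q hq
    by_contra hqr
    rw [mem_closedBall_iff_norm, not_le] at hqr
    have hlt := euclideanHausdorffMeasure_sphere_lt_frontier (by omega) hΩ.isOpen hΩ.isBounded
      hΩ.measure_lt_top.ne hr hball hq hqr
    exact absurd (hle.trans (two_mul_halfSphereArea_le x₀ hr)) (not_le.2 hlt)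
  have hΩball : Ω = Metric.ball x₀ (dist x₀ z) := by
    refine Subset.antisymm ?_ hball
    rw [← interior_closedBall x₀ hr.ne']
    exact interior_maximal hsub hΩ.isOpen
  conv_lhs => rw [hΩball]
  exact frontier_ball x₀ hr.ne'
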